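/- Let $d\in\mathbb C$ with $\operatorname{Re}d>0$, $\omega_0>0$, $\mu_0\le-\omega_0$. For a source $I_a:\mathbb R\to\mathbb R$ put $$g(x,\tau)=\frac1{\sqrt{4\pi d\tau}}\int_{\mathbb R}e^{-(x-y)^2/(4d\tau)}I_a(y)\,dy$$ (principal root), and let $A_p$ be the particular solution, with zero data at $\mu=\mu_0$, of $\varepsilon A_\mu=(\mu+i\omega_0)A+\sqrt\varepsilon I_a(x)+\varepsilon dA_{xx}$ given by Duhamel's formula $$A_p(x,\mu)=e^{(\mu+i\omega_0)^2/2\varepsilon}\,\frac1{\sqrt\varepsilon}\int_{\mu_0}^{\mu}g(x,\mu-s)\,e^{-(s+i\omega_0)^2/2\varepsilon}\,ds .$$ The space-time buffer curve is the set of $(\mu,x)$ with $g(x,\mu+i\omega_0)\ne0$ and $$\operatorname{Re}\Big(\ln\big(\sqrt{2\pi}\,g(x,\mu+i\omega_0)\big)+\tfrac1{2\varepsilon}(\mu+i\omega_0)^2\Big)=0. \tag{1}$$ **(0)** For $\varepsilon>0$ and real $\mu$, condition (1) (together with $g\neq0$) is equivalent to $|\sqrt{2\pi}\,g(x,\mu+i\omega_0)\,e^{(\mu+i\omega_0)^2/2\varepsilon}|=1$,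 and to $g\ne0$ together with $$\mu^2=\omega_0^2-\varepsilon\ln 2\pi-2\varepsilon\ln|g(x,\mu+i\omega_0)|. \tag{2}$$ Let $X\subseteq\mathbb R$, $0<a$, and $M\in\mathbb R$, and assume one of the following: * (A) $I_a$ is bounded and measurable and $\operatorname{Re}(d(a+i\omega_0))>0$; then $g(x,\mu+i\omega_0)$ is the convolution integral itself; * (B) for some $0<m<a$ and $h>\omega_0$, for all $x\in X$ the integral $g(x,t)$ converges absolutely for all $t>0$ and $g(x,\cdot)$ has an analytic continuation from $(0,\infty)$ to a neighbourhood of $\{\tau\ne0:\ 0\le\operatorname{Im}\tau\le h,\ m\operatorname{Im}\tau\le\omega_0\operatorname{Re}\tau\}$ that is bounded on the bounded parts of this set, uniformly in $x\in X$; then $g(x,\mu+i\omega_0)$ is the value of this continuation. Then, as $\varepsilon\to0^+$, with constants independent of $x\in X$ and $\mu\in[a,M]$: **(i)** for $x\in X$ and $\mu\in[a,M]$ with $\mu\ge\omega_0$, $$A_p(x,\mu)=\big(\sqrt{2\pi}\,g(x,\mu+i\omega_0)+O(\sqrt\varepsilon)\big)e^{(\mu+i\omega_0)^2/2\varepsilon}.$$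 **(ii)** For every $c>0$, for $x\in X$, $\mu\in[a,M]$ with $|g(x,\mu+i\omega_0)|\ge c$ (constants depending on $c$): if $|A_p(x,\mu)|=1$, then $\mu^2=\omega_0^2-\varepsilon\ln2\pi-2\varepsilon\ln|g(x,\mu+i\omega_0)|+O(\varepsilon^{3/2})$; and if $(\mu,x)$ is on the space-time buffer curve, then $|A_p(x,\mu)|=1+O(\sqrt\varepsilon)$. **(iii)** If $a<\omega_0<M$ and $|g(x,\mu+i\omega_0)|\ge c>0$ for all $x\in X$, $\mu\in[a,M]$, then for all sufficiently small $\varepsilon$ and all $x\in X$ there is exactly one $\mu_{\rm stbc}(x)\in[a,M]$ with $(\mu_{\rm stbc}(x),x)$ on the space-time buffer curve; the equation $|A_p(x,\mu)|=1$ has a solution $\mu\in[a,M]$, and every such solution satisfies $|\mu-\mu_{\rm stbc}(x)|\le C\varepsilon^{3/2}$, with $C$ independent of $x$ and $\varepsilon$. **Gaussian source.** Let $I_a(x)=e^{-x^2/4\sigma}$, $\sigma>0$, and $$g(x,\tau)=\sqrt{\frac{\sigma}{d\tau+\sigma}}\;e^{-x^2/4(d\tau+\sigma)}.$$ This equals the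 convolution integral whenever $\operatorname{Re}\tau>0$, $\operatorname{Im}\tau\ge0$, $\operatorname{Re}\frac{d\tau+\sigma}{d\tau}>0$, and it is an analytic continuation as in (B), for $X=[-R,R]$ and any $R$, $m>0$, $h$. Hence (i) and (ii) hold for $X=[-R,R]$ and all $0<a$, $M$, and the conclusion of (iii) holds whenever also $a<\omega_0<M$, without further assumption. With $d=d_R+id_I$, for $\varepsilon,\mu>0$ and $x\in\mathbb R$ the space-time buffer curve is exactly $$\mu^2=\omega_0^2+\frac{\varepsilon x^2(d_R\mu-d_I\omega_0+\sigma)}{2\left((d_R\mu-d_I\omega_0+\sigma)^2+(d_R\omega_0+d_I\mu)^2\right)}-\varepsilon\ln(2\pi\sigma)+\frac\varepsilon2\ln\left((d_R\mu-d_I\omega_0+\sigma)^2+(d_R\omega_0+d_I\mu)^2\right).$$ **Error-function source.** Let $I_a(x)=I_{\rm ave}+I_{\rm e}\operatorname{erf}(x)$, $I_{\rm ave}>I_{\rm e}>0$, and $$g(x,\tau)=I_{\rm ave}+I_{\rm e}\operatorname{erf}\Big(\frac{x}{\sqrt{1+4d\tau}}\Big),$$ with $\operatorname{erf}$ the entire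 error function. This equals the convolution integral whenever $\operatorname{Re}(d\tau)>0$, and it is an analytic continuation as in (B), for $X=[-R,R]$ and any $R$, $m>0$, $h$. Hence (i), (ii), (iii) hold for every bounded $X$ and all $0<a$, $M$. For $\varepsilon,\mu>0$ and $x\in\mathbb R$ the space-time buffer curve is exactly the set where $g(x,\mu+i\omega_0)\ne0$ and $$\mu^2=\omega_0^2-2\varepsilon\ln\left|I_{\rm ave}+I_{\rm e}\operatorname{erf}\Big(\frac{x}{\sqrt{1+4d(\mu+i\omega_0)}}\Big)\right|-\varepsilon\ln(2\pi).$$ -/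

import Mathlib

open Set MeasureTheory

noncomputable section

/-- The heat-kernel convolution
`g(x,τ) = (4πdτ)^(-1/2) ∫ exp(-(x-y)²/(4dτ)) I_a(y) dy`, with complex diffusivity `d`
and complex time `τ` (principal square root). -/
def heatConv (d : ℂ) (src : ℝ → ℝ) (x : ℝ) (τ : ℂ) : ℂ :=
  (1 / (4 * (Real.pi : ℂ) * d * τ) ^ (1 / 2 : ℂ)) *
    ∫ y : ℝ, Complex.exp (-((x : ℂ) - y) ^ 2 / (4 * d * τ)) * (src y : ℂ)

/-- The saddle-point phase factor `exp((μ+iω₀)²/(2ε))`. -/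
def phaseExp (ε ω₀ μ : ℝ) : ℂ :=
  Complex.exp (((μ : ℂ) + ω₀ * Complex.I) ^ 2 / (2 * (ε : ℂ)))

/-- The Duhamel integral
`B_p(x,μ) = ε^(-1/2) ∫_{μ₀}^{μ} g(x,μ-s) exp(-(s+iω₀)²/(2ε)) ds`. -/
def Bp (ε : ℝ) (d : ℂ) (src : ℝ → ℝ) (ω₀ μ₀ x μ : ℝ) : ℂ :=
  (1 / (Real.sqrt ε : ℂ)) *
    ∫ s in μ₀..μ, heatConv d src x ((μ : ℂ) - s) *
      Complex.exp (-((s : ℂ) + ω₀ * Complex.I) ^ 2 / (2 * (ε : ℂ)))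

/-- The particular solution (zero data at `μ₀`) of
`ε A_μ = (μ+iω₀) A + √ε I_a(x) + ε d A_xx`, namely `A_p = B_p exp((μ+iω₀)²/(2ε))`. -/
def Ap (ε : ℝ) (d : ℂ) (src : ℝ → ℝ) (ω₀ μ₀ x μ : ℝ) : ℂ :=
  Bp ε d src ω₀ μ₀ x μ * phaseExp ε ω₀ μ

/-- The complex times `τ ≠ 0` with `0 ≤ Im τ ≤ h` lying on or below the ray from `0` through
`m + iω₀`. -/
def timeSector (ω₀ m h : ℝ) : Set ℂ :=
  {τ : ℂ | τ ≠ 0 ∧ 0 ≤ τ.im ∧ τ.im ≤ h ∧ m * τ.im ≤ ω₀ * τ.re}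

/-- For every `x ∈ X` the heat-kernel convolution of `src` converges at all positive real times,
and `G x` is its analytic continuation to (a neighbourhood of) `Ω`, bounded on bounded parts
of `Ω` uniformly in `x ∈ X`. -/
structure HeatContinuation (d : ℂ) (src : ℝ → ℝ) (Ω : Set ℂ) (X : Set ℝ)
    (G : ℝ → ℂ → ℂ) : Prop where
  integrable : ∀ x ∈ X, ∀ t : ℝ, 0 < t →
    Integrable (fun y : ℝ => Complex.exp (-((x : ℂ) - y) ^ 2 / (4 * d * (t : ℂ))) * (src y : ℂ))
  analytic : ∀ x ∈ X, AnalyticOnNhd ℂ (G x) Ω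
  agrees : ∀ x ∈ X, ∀ t : ℝ, 0 < t → (t : ℂ) ∈ Ω → G x (t : ℂ) = heatConv d src x (t : ℂ)
  bounded : ∀ L : ℝ, ∃ C : ℝ, ∀ x ∈ X, ∀ τ ∈ Ω, ‖τ‖ ≤ L → ‖G x τ‖ ≤ C

/-- `A_p(x,μ) = (√(2π) g(x,μ+iω₀) + O(√ε)) exp((μ+iω₀)²/(2ε))` as `ε → 0⁺`, uniformly for `x ∈ X`
and `μ ∈ [a,M]` with `μ ≥ ω₀`; here `G` is `g` at complex times. -/
def ParticularAsymptotics (d : ℂ) (src : ℝ → ℝ) (ω₀ μ₀ : ℝ) (X : Set ℝ) (a M : ℝ)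
    (G : ℝ → ℂ → ℂ) : Prop :=
  ∃ C > 0, ∃ ε₀ > 0, ∀ ε : ℝ, 0 < ε → ε ≤ ε₀ → ∀ x ∈ X, ∀ μ ∈ Icc a M, ω₀ ≤ μ →
    ∃ r : ℂ, ‖r‖ ≤ C * Real.sqrt ε ∧
      Ap ε d src ω₀ μ₀ x μ =
        ((Real.sqrt (2 * Real.pi) : ℂ) * G x ((μ : ℂ) + ω₀ * Complex.I) + r) * phaseExp ε ω₀ μ

/-- The defining condition of the space-time buffer curve,
`Re(ln(√(2π) z) + (μ+iω₀)²/(2ε)) = 0` with `z = g(x,μ+iω₀) ≠ 0`. -/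
def OnBufferCurve (ε ω₀ : ℝ) (z : ℂ) (μ : ℝ) : Prop :=
  z ≠ 0 ∧
    (Complex.log ((Real.sqrt (2 * Real.pi) : ℂ) * z) +
      ((μ : ℂ) + ω₀ * Complex.I) ^ 2 / (2 * (ε : ℂ))).re = 0

/-- Where `|g(x,μ+iω₀)| ≥ c`: the condition `|A_p| = 1` gives
`μ² = ω₀² - ε ln 2π - 2ε ln|g(x,μ+iω₀)| + O(ε^(3/2))`, and conversely `|A_p| = 1 + O(√ε)` along the
space-time buffer curve; uniformly for `x ∈ X`, `μ ∈ [a,M]`. -/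
def BufferCurveApprox (d : ℂ) (src : ℝ → ℝ) (ω₀ μ₀ : ℝ) (X : Set ℝ) (a M : ℝ)
    (G : ℝ → ℂ → ℂ) : Prop :=
  ∀ c > 0, ∃ C > 0, ∃ ε₀ > 0, ∀ ε : ℝ, 0 < ε → ε ≤ ε₀ → ∀ x ∈ X, ∀ μ ∈ Icc a M,
    c ≤ ‖G x ((μ : ℂ) + ω₀ * Complex.I)‖ →
      (‖Ap ε d src ω₀ μ₀ x μ‖ = 1 →
        |μ ^ 2 - (ω₀ ^ 2 - ε * Real.log (2 * Real.pi)
            - 2 * ε * Real.log ‖G x ((μ : ℂ) + ω₀ * Complex.I)‖)| ≤ C * (ε * Real.sqrt ε)) ∧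
      (OnBufferCurve ε ω₀ (G x ((μ : ℂ) + ω₀ * Complex.I)) μ →
        |‖Ap ε d src ω₀ μ₀ x μ‖ - 1| ≤ C * Real.sqrt ε)

/-- For all small `ε` and all `x ∈ X`: the buffer-curve condition has exactly one solution
`ν = μ_stbc(x)` in `[a,M]`, the equation `|A_p(x,μ)| = 1` has a solution there, and all its
solutions there are within `O(ε^(3/2))` of `ν`, uniformly in `x`. -/
def BufferCurveLocated (d : ℂ) (src : ℝ → ℝ) (ω₀ μ₀ : ℝ) (X : Set ℝ) (a M : ℝ)
    (G : ℝ → ℂ → ℂ) : Prop :=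
  ∃ C > 0, ∃ ε₀ > 0, ∀ ε : ℝ, 0 < ε → ε ≤ ε₀ → ∀ x ∈ X,
    ∃ ν ∈ Icc a M, OnBufferCurve ε ω₀ (G x ((ν : ℂ) + ω₀ * Complex.I)) ν ∧
      (∀ ν' ∈ Icc a M, OnBufferCurve ε ω₀ (G x ((ν' : ℂ) + ω₀ * Complex.I)) ν' → ν' = ν) ∧
      (∃ μ ∈ Icc a M, ‖Ap ε d src ω₀ μ₀ x μ‖ = 1) ∧
      (∀ μ ∈ Icc a M, ‖Ap ε d src ω₀ μ₀ x μ‖ = 1 → |μ - ν| ≤ C * (ε * Real.sqrt ε))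

/-- The Gaussian source. -/
def gaussSource (σ : ℝ) (x : ℝ) : ℝ := Real.exp (-x ^ 2 / (4 * σ))

/-- `√(σ/(dτ+σ)) exp(-x²/(4(dτ+σ)))`. -/
def gaussG (d : ℂ) (σ : ℝ) (x : ℝ) (τ : ℂ) : ℂ :=
  ((σ : ℂ) / (d * τ + σ)) ^ (1 / 2 : ℂ) * Complex.exp (-(x : ℂ) ^ 2 / (4 * (d * τ + σ)))

/-- The error function on the real line. -/
def erfReal (x : ℝ) : ℝ := 2 / Real.sqrt Real.pi * ∫ t in (0 : ℝ)..x, Real.exp (-t ^ 2)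

/-- The entire error function, as the integral of `2/√π exp(-ζ²)` along the segment `[0,z]`. -/
def erfComplex (z : ℂ) : ℂ :=
  2 / (Real.sqrt Real.pi : ℂ) * ∫ t in (0 : ℝ)..1, z * Complex.exp (-((t : ℂ) * z) ^ 2)

/-- The smoothed step source `I_ave + I_e erf(x)`. -/
def erfSource (Iave Ie : ℝ) (x : ℝ) : ℝ := Iave + Ie * erfReal x

/-- `I_ave + I_e erf(x/√(1+4dτ))`. -/
def erfG (d : ℂ) (Iave Ie : ℝ) (x : ℝ) (τ : ℂ) : ℂ :=
  (Iave : ℂ) + Ie * erfComplex ((x : ℂ) / (1 + 4 * d * τ) ^ (1 / 2 : ℂ))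

end

/-!
The elapsed time `τ = μ - s` turns the Duhamel integral into `∫₀^{μ-μ₀} g(x,τ) K(τ) dτ` with
`K(τ) = exp(-(μ-τ+iω₀)²/(2ε))`, whose saddle point is `τ = μ + iω₀`. Since `g(x,·)` is analytic on the
convex sector `timeSector ω₀ m h`, `g(x,·) K` has a primitive there, and the real segment may be
replaced by the ray from `0` to `m + iω₀`, the horizontal segment through the saddle point to
`μ - μ₀ + iω₀`, and the vertical segment back to the real axis (`integral_eq_saddle_contour`; at the
vertex `0` boundedness of `g` suffices).

On the horizontal segment `K` is the real Gaussian `exp(-(μ-u)²/(2ε))`, and a uniform Lipschitz bound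
for `g` on this line, from Cauchy's estimate, yields `√(2πε) g(x,μ+iω₀) + O(ε)`
(`norm_laplace_sub_le`). On the vertical segment `K` decays exponentially because `μ₀ ≤ -ω₀`. On the
ray `|K|` is at most a decaying exponential if `μ ≥ ω₀`, and such an exponential times its value
`1 / |exp((μ+iω₀)²/(2ε))|` at `τ = 0` if `μ ≤ ω₀`. Together these give
`A_p = (√(2π) g + r) exp((μ+iω₀)²/(2ε)) + s` with `r, s = O(√ε)` and `s = 0` for `μ ≥ ω₀`
(`exists_saddle_decomposition`).

Taking moduli and logarithms gives the approximation of the set `|A_p| = 1` by the buffer curve. The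
function `μ² - ω₀² + ε ln 2π + 2ε ln|g|` vanishes exactly on the buffer curve and has slope at least `a`
for small `ε`, hence a unique zero, and the intermediate value theorem supplies a solution of
`|A_p| = 1` (`bufferCurveLocated_of_continuation`).

For a bounded source the convolution integral itself is analytic, and bounded on subsectors, in
`Re (dτ) > 0` (`heatContinuation_heatConv`). For the Gaussian source the convolution is a Gaussian
integral, where the only issue is the branch of the square root (`cpow_half_mul_div_add`). For the
error-function source the `x`-derivative reduces it to the Gaussian case (`erf_convolution`).
-/

/-! ### The buffer-curve condition -/

lemma re_saddle (ε ω₀ μ : ℝ) :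
    (((μ : ℂ) + ω₀ * Complex.I) ^ 2 / (2 * (ε : ℂ))).re = (μ ^ 2 - ω₀ ^ 2) / (2 * ε) := by
  have h : (2 * (ε : ℂ)) = ((2 * ε : ℝ) : ℂ) := by push_cast; ring
  rw [h, Complex.div_ofReal_re]
  simp [pow_two]

lemma norm_phaseExp (ε ω₀ μ : ℝ) :
    ‖phaseExp ε ω₀ μ‖ = Real.exp ((μ ^ 2 - ω₀ ^ 2) / (2 * ε)) := by
  rw [phaseExp, Complex.norm_exp, re_saddle]

lemma sqrt_two_pi_pos : 0 < Real.sqrt (2 * Real.pi) := by positivity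

lemma norm_sqrt_two_pi : ‖(Real.sqrt (2 * Real.pi) : ℂ)‖ = Real.sqrt (2 * Real.pi) := by
  rw [Complex.norm_real, Real.norm_of_nonneg sqrt_two_pi_pos.le]

lemma onBufferCurve_iff_log {ε ω₀ μ : ℝ} {z : ℂ} :
    OnBufferCurve ε ω₀ z μ ↔ z ≠ 0 ∧
      Real.log (2 * Real.pi) / 2 + Real.log ‖z‖ + (μ ^ 2 - ω₀ ^ 2) / (2 * ε) = 0 := by
  unfold OnBufferCurve
  refine and_congr_right fun hz => ?_
  rw [Complex.add_re, re_saddle, Complex.log_re, norm_mul, norm_sqrt_two_pi,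
    Real.log_mul sqrt_two_pi_pos.ne' (norm_ne_zero_iff.2 hz),
    Real.log_sqrt (by positivity)]

lemma onBufferCurve_iff_sq {ε ω₀ μ : ℝ} {z : ℂ} (hε : 0 < ε) :
    OnBufferCurve ε ω₀ z μ ↔
      z ≠ 0 ∧ μ ^ 2 = ω₀ ^ 2 - ε * Real.log (2 * Real.pi) - 2 * ε * Real.log ‖z‖ := by
  rw [onBufferCurve_iff_log]
  refine and_congr_right fun _ => ?_
  field_simp
  constructor <;> intro h <;> linarith

lemma onBufferCurve_iff_norm {ε ω₀ μ : ℝ} {z : ℂ} :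
    OnBufferCurve ε ω₀ z μ ↔
      ‖(Real.sqrt (2 * Real.pi) : ℂ) * z * phaseExp ε ω₀ μ‖ = 1 := by
  rw [onBufferCurve_iff_log, norm_mul, norm_mul, norm_sqrt_two_pi, norm_phaseExp]
  by_cases hz : z = 0
  · simp [hz]
  have hz' : 0 < ‖z‖ := norm_pos_iff.2 hz
  have key : Real.sqrt (2 * Real.pi) * ‖z‖ * Real.exp ((μ ^ 2 - ω₀ ^ 2) / (2 * ε)) =
      Real.exp (Real.log (2 * Real.pi) / 2 + Real.log ‖z‖ + (μ ^ 2 - ω₀ ^ 2) / (2 * ε)) := by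
    rw [Real.exp_add, Real.exp_add, Real.exp_log hz', ← Real.log_sqrt (by positivity),
      Real.exp_log sqrt_two_pi_pos]
  rw [key, Real.exp_eq_one_iff]
  exact ⟨fun h => h.2, fun h => ⟨hz, h⟩⟩

/-! ### Deforming the contour of the Duhamel integral -/

lemma timeSector_re_pos {ω₀ m h : ℝ} (hm : 0 < m) (hω₀ : 0 < ω₀) {u : ℂ}
    (hu : u ∈ timeSector ω₀ m h) : 0 < u.re := by
  obtain ⟨hu0, h1, -, h2⟩ := hu
  by_contra hre
  have h4 : m * u.im ≤ 0 := h2.trans (by nlinarith)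
  have h5 : u.im = 0 := by nlinarith
  rw [h5] at h2
  exact hu0 (Complex.ext (by simp; nlinarith) (by simpa using h5))

lemma timeSector_convex (ω₀ m h : ℝ) (hm : 0 < m) (hω₀ : 0 < ω₀) :
    Convex ℝ (timeSector ω₀ m h) := by
  intro z hz w hw s t hs ht hst
  have hzr := timeSector_re_pos hm hω₀ hz
  have hwr := timeSector_re_pos hm hω₀ hw
  obtain ⟨hz0, hz1, hz2, hz3⟩ := hz
  obtain ⟨hw0, hw1, hw2, hw3⟩ := hw
  refine ⟨?_, ?_, ?_, ?_⟩
  · intro h0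
    have := congrArg Complex.re h0
    simp at this
    rcases hs.eq_or_lt with rfl | hs'
    · have : t = 1 := by linarith
      subst this; simp at this; linarith
    · nlinarith [mul_pos hs' hzr, mul_nonneg ht hwr.le]
  · simp; positivity
  · simp
    calc s * z.im + t * w.im ≤ s * h + t * h := by gcongr
      _ = h := by rw [← add_mul, hst, one_mul]
  · simp
    nlinarith [mul_le_mul_of_nonneg_left hz3 hs, mul_le_mul_of_nonneg_left hw3 ht]

lemma intervalIntegrable_of_continuousOn_Ioc {f : ℝ → ℂ} {a b C : ℝ} (hab : a ≤ b)
    (hf : ContinuousOn f (Ioc a b)) (hC : ∀ t ∈ Ioc a b, ‖f t‖ ≤ C) :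
    IntervalIntegrable f volume a b := by
  rw [intervalIntegrable_iff_integrableOn_Ioc_of_le hab]
  refine IntegrableOn.of_bound (by simp) (hf.aestronglyMeasurable measurableSet_Ioc) C ?_
  exact (ae_restrict_iff' measurableSet_Ioc).2 (.of_forall hC)

/-- Fundamental theorem of calculus along an affine path inside a set on which `P` is a
complex primitive of `f`. -/
lemma integral_affine_of_primitive {S : Set ℂ} {f P : ℂ → ℂ}
    (hf : ContinuousOn f S) (hP : ∀ z ∈ S, HasDerivWithinAt P (f z) S z)
    {a b : ℝ} (hab : a ≤ b) (z v : ℂ) (hS : ∀ t ∈ Icc a b, z + t * v ∈ S) :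
    ∫ t in a..b, f (z + t * v) * v = P (z + b * v) - P (z + a * v) := by
  have hmap : MapsTo (fun t : ℝ => z + t * v) (Icc a b) S := hS
  have hd : ∀ t : ℝ, HasDerivAt (fun t : ℝ => z + t * v) v t := by
    intro t
    simpa using ((Complex.ofRealCLM.hasDerivAt (x := t)).mul_const v).const_add z
  have hcont : ContinuousOn (fun t : ℝ => z + t * v) (Icc a b) := by fun_prop
  refine intervalIntegral.integral_eq_sub_of_hasDeriv_right_of_le hab
    (f := fun t : ℝ => P (z + t * v)) ?_ ?_ ?_
  · have hPc : ContinuousOn P S := fun w hw => (hP w hw).continuousWithinAt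
    exact hPc.comp hcont hmap
  · intro t ht
    have h1 : HasDerivWithinAt (fun t : ℝ => P (z + t * v)) (f (z + t * v) * v) (Icc a b) t := by
      have := (hP _ (hS t (Ioo_subset_Icc_self ht))).scomp t ((hd t).hasDerivWithinAt
        (s := Icc a b)) hmap
      simpa [mul_comm, Function.comp_def] using this
    exact (h1.hasDerivAt (Icc_mem_nhds ht.1 ht.2)).hasDerivWithinAt
  · refine ContinuousOn.intervalIntegrable ?_
    rw [uIcc_of_le hab]
    exact (hf.comp hcont hmap).mul continuousOn_const

/-- Cauchy's theorem for a triangle with a vertex at `0`, where the integrand is bounded but need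
not be continuous; the third side is expressed through the primitive `P`. -/
lemma integral_ray_sub_integral_ray {S : Set ℂ} {f P : ℂ → ℂ} {C : ℝ} (hS : Convex ℝ S)
    (hcone : ∀ z ∈ S, ∀ t : ℝ, 0 < t → t ≤ 1 → (t : ℂ) * z ∈ S)
    (hf : ContinuousOn f S) (hC : ∀ z ∈ S, ‖f z‖ ≤ C)
    (hP : ∀ z ∈ S, HasDerivWithinAt P (f z) S z) {A B : ℂ} (hA : A ∈ S) (hB : B ∈ S) :
    (∫ t in (0 : ℝ)..1, f (t * A) * A) - ∫ t in (0 : ℝ)..1, f (t * B) * B = P A - P B := by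
  have hint : ∀ z ∈ S, IntervalIntegrable (fun t : ℝ => f (t * z) * z) volume 0 1 := by
    intro z hz
    refine intervalIntegrable_of_continuousOn_Ioc (C := C * ‖z‖) zero_le_one ?_ ?_
    · refine ContinuousOn.mul (hf.comp (by fun_prop) fun t ht => hcone z hz t ht.1 ht.2)
        continuousOn_const
    · intro t ht
      rw [norm_mul]
      gcongr
      exact hC _ (hcone z hz t ht.1 ht.2)
  -- the path integral from `δ z` to `z` tends to the one from `0`
  have hlim : ∀ z ∈ S, Filter.Tendsto (fun δ : ℝ => ∫ t in δ..1, f (t * z) * z)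
      (nhdsWithin 0 (Ioi 0)) (nhds (∫ t in (0 : ℝ)..1, f (t * z) * z)) := by
    intro z hz
    have h1 : ContinuousWithinAt (fun δ : ℝ => ∫ t in (1 : ℝ)..δ, f (t * z) * z)
        (uIcc (1 : ℝ) 0) 0 :=
      intervalIntegral.continuousOn_primitive_interval'
        (hint z hz).symm (left_mem_uIcc) 0 right_mem_uIcc
    have h2 : Filter.Tendsto (fun δ : ℝ => ∫ t in (1 : ℝ)..δ, f (t * z) * z)
        (nhdsWithin 0 (Ioi 0)) (nhds (∫ t in (1 : ℝ)..0, f (t * z) * z)) := by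
      refine h1.tendsto.mono_left ?_
      rw [uIcc_of_ge zero_le_one]
      refine nhdsWithin_le_of_mem ?_
      exact Filter.mem_of_superset (Ioc_mem_nhdsGT (zero_lt_one)) Ioc_subset_Icc_self
    have := h2.neg
    simpa only [← intervalIntegral.integral_symm] using this
  have hF : ∀ z ∈ S, ∀ δ : ℝ, 0 < δ → δ ≤ 1 →
      ∫ t in δ..1, f (t * z) * z = P z - P (δ * z) := by
    intro z hz δ h0 h1
    have := integral_affine_of_primitive hf hP h1 0 z
      (fun t ht => by simpa using hcone z hz t (h0.trans_le ht.1) ht.2)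
    simpa using this
  have hPlip : ∀ δ : ℝ, 0 < δ → δ ≤ 1 → ‖P (δ * A) - P (δ * B)‖ ≤ C * (δ * ‖A - B‖) := by
    intro δ h0 h1
    have := hS.norm_image_sub_le_of_norm_hasDerivWithin_le (f := P) (f' := f) (C := C)
      hP hC (hcone B hB δ h0 h1) (hcone A hA δ h0 h1)
    rwa [← mul_sub, norm_mul, Complex.norm_real, Real.norm_of_nonneg h0.le] at this
  have hdiff := (hlim A hA).sub (hlim B hB)
  refine tendsto_nhds_unique hdiff ?_
  have hz : Filter.Tendsto (fun δ : ℝ => (P A - P B) - (P (δ * A) - P (δ * B)))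
      (nhdsWithin 0 (Ioi 0)) (nhds (P A - P B)) := by
    have : Filter.Tendsto (fun δ : ℝ => P (δ * A) - P (δ * B))
        (nhdsWithin 0 (Ioi 0)) (nhds 0) := by
      refine squeeze_zero_norm' (a := fun δ : ℝ => C * (δ * ‖A - B‖)) ?_ ?_
      · filter_upwards [Ioc_mem_nhdsGT (zero_lt_one (α := ℝ))] with δ hδ
        exact hPlip δ hδ.1 hδ.2
      · have : Continuous (fun δ : ℝ => C * (δ * ‖A - B‖)) := by fun_prop
        simpa using (this.tendsto 0).mono_left nhdsWithin_le_nhds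
    simpa using this.const_sub (P A - P B)
  refine hz.congr' ?_
  filter_upwards [Ioc_mem_nhdsGT (zero_lt_one (α := ℝ))] with δ hδ
  rw [hF A hA δ hδ.1 hδ.2, hF B hB δ hδ.1 hδ.2]
  ring

/-- The real segment `[0, L]` is deformed into the ray from `0` to `m + iω₀`, the horizontal
segment from there to `L + iω₀`, and the vertical segment back down to `L`. -/
lemma integral_eq_saddle_contour {ω₀ m h L C : ℝ} (hm : 0 < m) (hω₀ : 0 < ω₀) (hh : ω₀ ≤ h)
    (hL : m ≤ L) {f : ℂ → ℂ} (hf : DifferentiableOn ℂ f (timeSector ω₀ m h))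
    (hC : ∀ z ∈ timeSector ω₀ m h, ‖z‖ ≤ L + ω₀ → ‖f z‖ ≤ C) :
    ∫ τ in (0 : ℝ)..L, f τ =
      (∫ t in (0 : ℝ)..1, f (t * (m + ω₀ * Complex.I)) * (m + ω₀ * Complex.I)) +
      (∫ u in m..L, f (u + ω₀ * Complex.I)) -
      ∫ v in (0 : ℝ)..ω₀, f (L + v * Complex.I) * Complex.I := by
  set S : Set ℂ := timeSector ω₀ m h ∩ Metric.closedBall 0 (L + ω₀) with hSdef
  have hSc : Convex ℝ S := (timeSector_convex ω₀ m h hm hω₀).inter (convex_closedBall _ _)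
  have hfS : DifferentiableOn ℂ f S := hf.mono inter_subset_left
  have hCS : ∀ z ∈ S, ‖f z‖ ≤ C := fun z hz => hC z hz.1 (by simpa using hz.2)
  obtain ⟨P, hP⟩ := hSc.exists_forall_hasDerivWithinAt hfS
  have hL0 : 0 < L := hm.trans_le hL
  have hmem : ∀ u v : ℝ, 0 < u → u ≤ L → 0 ≤ v → v ≤ ω₀ → m * v ≤ ω₀ * u →
      (u : ℂ) + v * Complex.I ∈ S := by
    intro u v hu huL hv hvω hc
    refine ⟨⟨?_, by simpa using hv, by simpa using hvω.trans hh, by simpa using hc⟩, ?_⟩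
    · intro h0
      have := congrArg Complex.re h0
      simp at this
      exact hu.ne' this
    · have : ‖(u : ℂ) + v * Complex.I‖ ≤ u + v := by
        refine (norm_add_le _ _).trans ?_
        simp [abs_of_pos hu, abs_of_nonneg hv]
      simpa using this.trans (add_le_add huL hvω)
  have hcone : ∀ z ∈ S, ∀ t : ℝ, 0 < t → t ≤ 1 → (t : ℂ) * z ∈ S := by
    rintro z ⟨⟨h0, h1, h2, h3⟩, h4⟩ t ht ht1
    refine ⟨⟨?_, ?_, ?_, ?_⟩, ?_⟩
    · simp [h0, ht.ne']
    · simp; positivity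
    · simp; nlinarith
    · simp; nlinarith
    · have : ‖z‖ ≤ L + ω₀ := by simpa using h4
      simp only [Metric.mem_closedBall, dist_zero_right, norm_mul, Complex.norm_real,
        Real.norm_of_nonneg ht.le]
      nlinarith [norm_nonneg z]
  have hA : (L : ℂ) ∈ S := by simpa using hmem L 0 hL0 le_rfl le_rfl hω₀.le (by simp; positivity)
  have hB : (m : ℂ) + ω₀ * Complex.I ∈ S :=
    hmem m ω₀ hm hL hω₀.le le_rfl (by rw [mul_comm])
  have h1 := integral_ray_sub_integral_ray hSc hcone hfS.continuousOn hCS hP hA hB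
  have h2 := integral_affine_of_primitive hfS.continuousOn hP hL (ω₀ * Complex.I) 1
    (fun u hu => by
      have := hmem u ω₀ (hm.trans_le hu.1) hu.2 hω₀.le le_rfl (by
        rw [mul_comm]; exact mul_le_mul_of_nonneg_left hu.1 hω₀.le)
      rwa [mul_one, add_comm])
  have h3 := integral_affine_of_primitive hfS.continuousOn hP hω₀.le L Complex.I
    (fun v hv => hmem L v hL0 le_rfl hv.1 hv.2 (by
      rw [mul_comm ω₀]; exact mul_le_mul hL hv.2 hv.1 hL0.le))
  have h4 : ∫ t in (0 : ℝ)..1, f (t * (L : ℂ)) * L = ∫ τ in (0 : ℝ)..L, f τ := by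
    have := intervalIntegral.integral_comp_mul_right (a := 0) (b := 1)
      (fun τ : ℝ => f τ) hL0.ne'
    rw [intervalIntegral.integral_mul_const]
    simp only [Complex.ofReal_mul, zero_mul, one_mul] at this
    rw [this, Complex.real_smul]
    push_cast
    field_simp
    exact mul_div_cancel_left₀ _ (by exact_mod_cast hL0.ne')
  rw [h4] at h1
  simp only [mul_one] at h2
  simp only [Complex.ofReal_zero, zero_mul, add_zero] at h3
  rw [h3, sub_eq_iff_eq_add'.1 h1]
  have h5 : ∀ u : ℝ, (u : ℂ) + ω₀ * Complex.I = ω₀ * Complex.I + u := fun u => add_comm _ _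
  simp only [h5, h2]
  ring

/-! ### Laplace-type estimates -/

lemma norm_integral_le_of_exp_decay {F : ℝ → ℂ} {T K κ ε : ℝ} (hT : 0 ≤ T) (hK : 0 ≤ K)
    (hκ : 0 < κ) (hε : 0 < ε) (hF : ∀ t ∈ Ioc 0 T, ‖F t‖ ≤ K * Real.exp (-(κ * t / ε))) :
    ‖∫ t in (0 : ℝ)..T, F t‖ ≤ K * (ε / κ) := by
  refine (intervalIntegral.norm_integral_le_of_norm_le hT (.of_forall hF)
    (Continuous.intervalIntegrable (by fun_prop) _ _)).trans ?_
  rw [intervalIntegral.integral_const_mul]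
  refine mul_le_mul_of_nonneg_left ?_ hK
  have h1 : ∀ t : ℝ, -(κ * t / ε) = (-(κ / ε)) * t := fun t => by ring
  simp only [h1]
  rw [intervalIntegral.integral_comp_mul_left (fun t => Real.exp t) (by
    have : 0 < κ / ε := by positivity
    linarith), integral_exp, mul_zero, Real.exp_zero, smul_eq_mul, inv_neg, inv_div]
  have : 0 < Real.exp (-(κ / ε) * T) := Real.exp_pos _
  have h2 : 0 < ε / κ := by positivity
  nlinarith

lemma integral_abs_mul_gaussian {ε : ℝ} (hε : 0 < ε) (μ : ℝ) :
    ∫ u : ℝ, |μ - u| * Real.exp (-(μ - u) ^ 2 / (2 * ε)) = 2 * ε := by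
  rw [integral_sub_left_eq_self (fun u : ℝ => |u| * Real.exp (-u ^ 2 / (2 * ε)))]
  have h1 := integral_comp_abs (f := fun u : ℝ => u * Real.exp (-u ^ 2 / (2 * ε)))
  simp only [sq_abs] at h1
  rw [h1]
  have h2 := integral_rpow_mul_exp_neg_mul_rpow (p := 2) (q := 1) (b := 1 / (2 * ε))
    two_pos (by norm_num) (by positivity)
  have h3 : ∫ x in Ioi (0 : ℝ), x * Real.exp (-x ^ 2 / (2 * ε)) = ε := by
    have : ∀ x : ℝ, x * Real.exp (-x ^ 2 / (2 * ε)) =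
        x ^ (1 : ℝ) * Real.exp (-(1 / (2 * ε)) * x ^ (2 : ℝ)) := by
      intro x
      rw [Real.rpow_one, Real.rpow_two]
      ring_nf
    simp only [this]
    rw [h2]
    norm_num [Real.rpow_neg_one]
    ring
  rw [h3]

lemma integrable_abs_mul_gaussian {ε : ℝ} (hε : 0 < ε) (μ : ℝ) :
    Integrable fun u : ℝ => |μ - u| * Real.exp (-(μ - u) ^ 2 / (2 * ε)) := by
  refine Integrable.of_integral_ne_zero ?_
  rw [integral_abs_mul_gaussian hε]
  positivity

lemma integrable_gaussian_sub {ε : ℝ} (hε : 0 < ε) (μ : ℝ) :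
    Integrable fun u : ℝ => Real.exp (-(μ - u) ^ 2 / (2 * ε)) := by
  have h := (integrable_exp_neg_mul_sq (b := 1 / (2 * ε)) (by positivity)).comp_sub_left μ
  refine h.congr (.of_forall fun u => ?_)
  simp only
  ring_nf

lemma integral_gaussian_sub {ε : ℝ} (μ : ℝ) :
    ∫ u : ℝ, Real.exp (-(μ - u) ^ 2 / (2 * ε)) = Real.sqrt (2 * Real.pi) * Real.sqrt ε := by
  rw [integral_sub_left_eq_self (fun u : ℝ => Real.exp (-u ^ 2 / (2 * ε)))]
  have := integral_gaussian (1 / (2 * ε))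
  rw [← Real.sqrt_mul (by positivity)]
  convert this using 1
  · congr 1; ext u; ring_nf
  · rw [one_div, div_inv_eq_mul]; ring_nf

/-- Laplace's method at a nondegenerate interior maximum `μ`. The hypothesis `hφ'` makes the
Lipschitz bound on `[m, L]` serve for the extension of `φ` by zero as well, so that the
truncated tails need no separate treatment. -/
lemma norm_laplace_sub_le {φ : ℝ → ℂ} {φ₀ : ℂ} {m L K μ ε : ℝ} (hε : 0 < ε) (hmL : m ≤ L)
    (hc : ContinuousOn φ (Icc m L))
    (hφ : ∀ u ∈ Icc m L, ‖φ u - φ₀‖ ≤ K * |μ - u|)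
    (hφ' : ∀ u, u ∉ Ioc m L → ‖φ₀‖ ≤ K * |μ - u|) :
    ‖(∫ u in m..L, φ u * (Real.exp (-(μ - u) ^ 2 / (2 * ε)) : ℂ)) -
      (Real.sqrt (2 * Real.pi) : ℂ) * Real.sqrt ε * φ₀‖ ≤ K * (2 * ε) := by
  set e : ℝ → ℝ := fun u => Real.exp (-(μ - u) ^ 2 / (2 * ε)) with he
  have hec : Continuous e := by fun_prop
  have hI1 : IntegrableOn (fun u => φ u * (e u : ℂ)) (Ioc m L) := by
    refine IntegrableOn.mono_set ?_ Ioc_subset_Icc_self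
    exact (hc.mul (by fun_prop)).integrableOn_Icc
  have hI2 : Integrable fun u : ℝ => φ₀ * (e u : ℂ) :=
    ((integrable_gaussian_sub hε μ).ofReal).const_mul φ₀
  have e2 : (Real.sqrt (2 * Real.pi) : ℂ) * Real.sqrt ε * φ₀ = ∫ u : ℝ, φ₀ * (e u : ℂ) := by
    rw [integral_const_mul, integral_complex_ofReal, integral_gaussian_sub]
    push_cast; ring
  rw [intervalIntegral.integral_of_le hmL, ← integral_indicator measurableSet_Ioc, e2,
    ← integral_sub (hI1.integrable_indicator measurableSet_Ioc) hI2,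
    ← integral_abs_mul_gaussian hε μ, ← integral_const_mul]
  refine norm_integral_le_of_norm_le ((integrable_abs_mul_gaussian hε μ).const_mul K)
    (.of_forall fun u => ?_)
  have hpos : 0 < e u := Real.exp_pos _
  have hn : ‖(e u : ℂ)‖ = e u := by rw [Complex.norm_real, Real.norm_of_nonneg hpos.le]
  by_cases hu : u ∈ Ioc m L
  · rw [indicator_of_mem hu, ← sub_mul, norm_mul, hn, ← mul_assoc]
    exact mul_le_mul_of_nonneg_right (hφ u (Ioc_subset_Icc_self hu)) hpos.le
  · rw [indicator_of_notMem hu, zero_sub, norm_neg, norm_mul, hn, ← mul_assoc]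
    exact mul_le_mul_of_nonneg_right (hφ' u hu) hpos.le

/-! ### Uniform bounds for the continuation near the line of saddle points -/

lemma HeatContinuation.mono {d : ℂ} {src : ℝ → ℝ} {Ω : Set ℂ} {X Y : Set ℝ} {G : ℝ → ℂ → ℂ}
    (H : HeatContinuation d src Ω Y G) (hXY : X ⊆ Y) : HeatContinuation d src Ω X G where
  integrable x hx := H.integrable x (hXY hx)
  analytic x hx := H.analytic x (hXY hx)
  agrees x hx := H.agrees x (hXY hx)
  bounded L := (H.bounded L).imp fun _ hC x hx => hC x (hXY hx)

lemma closedBall_subset_timeSector {ω₀ m m₁ h : ℝ} (hω₀ : 0 < ω₀) (hm : 0 < m) (hm₁ : m < m₁)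
    (hh : ω₀ < h) : ∃ ρ > 0, ∀ u : ℝ, m₁ ≤ u →
      Metric.closedBall ((u : ℂ) + ω₀ * Complex.I) ρ ⊆ timeSector ω₀ m h := by
  refine ⟨min (min (ω₀ / 2) (h - ω₀)) (ω₀ * (m₁ - m) / (m + ω₀)), ?_, ?_⟩
  · refine lt_min (lt_min (by positivity) (by linarith)) (div_pos ?_ (by positivity))
    exact mul_pos hω₀ (by linarith)
  intro u hu τ hτ
  set ρ := min (min (ω₀ / 2) (h - ω₀)) (ω₀ * (m₁ - m) / (m + ω₀)) with hρ
  have h1 : ρ ≤ ω₀ / 2 := (min_le_left _ _).trans (min_le_left _ _)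
  have h2 : ρ ≤ h - ω₀ := (min_le_left _ _).trans (min_le_right _ _)
  have h3 : ρ * (m + ω₀) ≤ ω₀ * (m₁ - m) := (le_div_iff₀ (by positivity)).1 (min_le_right _ _)
  have hτ' : ‖τ - ((u : ℂ) + ω₀ * Complex.I)‖ ≤ ρ := by simpa [dist_eq_norm] using hτ
  have hre := (Complex.abs_re_le_norm _).trans hτ'
  have him := (Complex.abs_im_le_norm _).trans hτ'
  simp at hre him
  rw [abs_le] at hre him
  refine ⟨?_, by linarith, by linarith, ?_⟩
  · rintro rfl
    simp at him
    linarith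
  · nlinarith [mul_le_mul_of_nonneg_left him.2 hm.le, mul_le_mul_of_nonneg_left hre.1 hω₀.le,
      mul_le_mul_of_nonneg_left hu hω₀.le]

/-- On the line `Im τ = ω₀`, the continuation is uniformly bounded and uniformly Lipschitz
around the points `μ + iω₀`, `μ ∈ [a, M]`. -/
lemma HeatContinuation.exists_lipschitz {d : ℂ} {src : ℝ → ℝ} {ω₀ m h : ℝ} {X : Set ℝ}
    {G : ℝ → ℂ → ℂ} (hω₀ : 0 < ω₀) (hm : 0 < m) (hh : ω₀ < h)
    (H : HeatContinuation d src (timeSector ω₀ m h) X G) {a : ℝ} (ha : m < a) (M Λ : ℝ)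
    (hΛ : M ≤ Λ) :
    ∃ K > 0, ∀ x ∈ X, ∀ μ ∈ Icc a M, ‖G x ((μ : ℂ) + ω₀ * Complex.I)‖ ≤ K ∧
      ∀ u ∈ Icc m Λ, ‖G x ((u : ℂ) + ω₀ * Complex.I) - G x ((μ : ℂ) + ω₀ * Complex.I)‖ ≤
        K * |μ - u| := by
  obtain ⟨m₁, hm₁, hm₁a⟩ := exists_between ha
  obtain ⟨ρ, hρ, hball⟩ := closedBall_subset_timeSector hω₀ hm hm₁ hh
  obtain ⟨C₀, hC₀⟩ := H.bounded (|Λ| + ω₀ + ρ)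
  set C := max C₀ 1 with hCdef
  have hC1 : 1 ≤ C := le_max_right _ _
  have hC : ∀ x ∈ X, ∀ τ ∈ timeSector ω₀ m h, ‖τ‖ ≤ |Λ| + ω₀ + ρ → ‖G x τ‖ ≤ C :=
    fun x hx τ hτ hn => (hC₀ x hx τ hτ hn).trans (le_max_left _ _)
  have hnorm : ∀ u : ℝ, m ≤ u → u ≤ Λ → ‖(u : ℂ) + ω₀ * Complex.I‖ ≤ |Λ| + ω₀ := by
    intro u hu huΛ
    refine (norm_add_le _ _).trans ?_
    simp only [Complex.norm_real, norm_mul, Complex.norm_I, mul_one, Real.norm_eq_abs,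
      abs_of_pos hω₀, abs_of_pos (hm.trans_le hu)]
    linarith [le_abs_self Λ]
  have hline : ∀ u : ℝ, m ≤ u → (u : ℂ) + ω₀ * Complex.I ∈ timeSector ω₀ m h := by
    intro u hu
    refine ⟨fun h0 => ?_, by simpa using hω₀.le, by simpa using hh.le, ?_⟩
    · have := congrArg Complex.im h0
      simp at this
      exact hω₀.ne' this
    · simp; nlinarith
  have hGb : ∀ x ∈ X, ∀ u ∈ Icc m Λ, ‖G x ((u : ℂ) + ω₀ * Complex.I)‖ ≤ C :=
    fun x hx u hu => hC x hx _ (hline u hu.1) ((hnorm u hu.1 hu.2).trans (by linarith))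
  have hder : ∀ x ∈ X, ∀ u ∈ Icc m₁ Λ, ‖deriv (G x) ((u : ℂ) + ω₀ * Complex.I)‖ ≤ C / ρ := by
    intro x hx u hu
    refine Complex.norm_deriv_le_of_forall_mem_sphere_norm_le hρ ?_ ?_
    · refine DifferentiableOn.diffContOnCl ?_
      refine (H.analytic x hx).differentiableOn.mono ?_
      exact Metric.closure_ball_subset_closedBall.trans (hball u hu.1)
    · intro z hz
      refine hC x hx z (hball u hu.1 (Metric.sphere_subset_closedBall hz)) ?_
      have h1 : ‖z - ((u : ℂ) + ω₀ * Complex.I)‖ = ρ := by simpa [dist_eq_norm] using hz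
      have h2 := hnorm u (hm₁.le.trans hu.1) hu.2
      have h3 := norm_add_le (z - ((u : ℂ) + ω₀ * Complex.I)) ((u : ℂ) + ω₀ * Complex.I)
      rw [sub_add_cancel] at h3
      linarith
  refine ⟨max C (max (C / ρ) (2 * C / (a - m₁))), lt_max_of_lt_left (by linarith), ?_⟩
  intro x hx μ hμ
  have hμm : μ ∈ Icc m Λ := ⟨ha.le.trans hμ.1, hμ.2.trans hΛ⟩
  refine ⟨(hGb x hx μ hμm).trans (le_max_left _ _), fun u hu => ?_⟩
  rcases le_or_gt m₁ u with hu1 | hu1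
  · have h1 : ∀ v ∈ Icc m₁ Λ, HasDerivWithinAt (fun v : ℝ => G x ((v : ℂ) + ω₀ * Complex.I))
        (deriv (G x) ((v : ℂ) + ω₀ * Complex.I)) (Icc m₁ Λ) v := by
      intro v hv
      have h2 := (H.analytic x hx _ (hline v (hm₁.le.trans hv.1))).differentiableAt.hasDerivAt
      have h3 : HasDerivAt (fun v : ℝ => (v : ℂ) + ω₀ * Complex.I) 1 v :=
        (Complex.ofRealCLM.hasDerivAt (x := v)).add_const _
      simpa [Function.comp_def] using (h2.scomp v h3).hasDerivWithinAt
    have h4 := (convex_Icc m₁ Λ).norm_image_sub_le_of_norm_hasDerivWithin_le h1 (hder x hx)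
      (⟨hm₁a.le.trans hμ.1, hμm.2⟩ : μ ∈ Icc m₁ Λ) ⟨hu1, hu.2⟩
    refine h4.trans ?_
    rw [Real.norm_eq_abs, abs_sub_comm]
    gcongr
    exact (le_max_left _ _).trans (le_max_right _ _)
  · have h1 : a - m₁ ≤ |μ - u| := le_trans (by linarith [hμ.1]) (le_abs_self _)
    have h2 : 0 < a - m₁ := by linarith
    calc _ ≤ ‖G x ((u : ℂ) + ω₀ * Complex.I)‖ + ‖G x ((μ : ℂ) + ω₀ * Complex.I)‖ :=
          norm_sub_le _ _
      _ ≤ 2 * C := by linarith [hGb x hx u hu, hGb x hx μ hμm]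
      _ = 2 * C / (a - m₁) * (a - m₁) := by field_simp
      _ ≤ _ := by
        gcongr
        exact (le_max_right _ _).trans (le_max_right _ _)

/-! ### Saddle-point decomposition of the particular solution -/

/-- The factor `exp(-(s+iω₀)²/(2ε))` of the Duhamel integrand, in the elapsed time `τ = μ - s`. -/
noncomputable def saddleKernel (ε ω₀ μ : ℝ) (τ : ℂ) : ℂ :=
  Complex.exp (-((μ : ℂ) - τ + ω₀ * Complex.I) ^ 2 / (2 * (ε : ℂ)))

lemma norm_saddleKernel (ε ω₀ μ : ℝ) (τ : ℂ) :
    ‖saddleKernel ε ω₀ μ τ‖ = Real.exp (((ω₀ - τ.im) ^ 2 - (μ - τ.re) ^ 2) / (2 * ε)) := by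
  have h : (2 * (ε : ℂ)) = ((2 * ε : ℝ) : ℂ) := by push_cast; ring
  rw [saddleKernel, Complex.norm_exp, h, Complex.div_ofReal_re]
  congr 2
  simp [pow_two]
  ring

lemma differentiable_saddleKernel (ε ω₀ μ : ℝ) : Differentiable ℂ (saddleKernel ε ω₀ μ) := by
  unfold saddleKernel
  fun_prop

lemma saddleKernel_line (ε ω₀ μ u : ℝ) :
    saddleKernel ε ω₀ μ ((u : ℂ) + ω₀ * Complex.I) =
      (Real.exp (-(μ - u) ^ 2 / (2 * ε)) : ℂ) := by
  rw [saddleKernel]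
  push_cast
  congr 2
  ring

lemma Bp_eq (ε : ℝ) (d : ℂ) (src : ℝ → ℝ) (ω₀ μ₀ x μ : ℝ) :
    Bp ε d src ω₀ μ₀ x μ = (1 / (Real.sqrt ε : ℂ)) *
      ∫ τ in (0 : ℝ)..(μ - μ₀), heatConv d src x τ * saddleKernel ε ω₀ μ τ := by
  have := intervalIntegral.integral_comp_sub_left (a := μ₀) (b := μ)
    (fun τ : ℝ => heatConv d src x τ * saddleKernel ε ω₀ μ τ) μ
  rw [sub_self] at this
  rw [Bp, ← this]
  simp [saddleKernel]

lemma ofReal_mem_timeSector {ω₀ m h t : ℝ} (hω₀ : 0 < ω₀) (hh : 0 ≤ h) (ht : 0 < t) :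
    (t : ℂ) ∈ timeSector ω₀ m h := by
  refine ⟨by exact_mod_cast ht.ne', by simp, by simpa using hh, ?_⟩
  simp
  positivity

/-- For `μ ≥ ω₀` the kernel is at most `1` at `τ = 0`, and it is exponentially small along the ray
towards `m + iω₀`, where `m < a ≤ μ`. -/
lemma norm_saddleKernel_ray_le {ε ω₀ m a μ t : ℝ} (hε : 0 < ε) (hω₀ : 0 < ω₀) (hm : 0 < m)
    (ha : m < a) (hμ : a ≤ μ) (hμω : ω₀ ≤ μ) (ht0 : 0 ≤ t) (ht1 : t ≤ 1) :
    ‖saddleKernel ε ω₀ μ (t * (m + ω₀ * Complex.I))‖ ≤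
      Real.exp (-((a - m) ^ 2 / 2 * t / ε)) := by
  rw [norm_saddleKernel, Real.exp_le_exp]
  simp
  rw [div_le_iff₀ (by positivity), show -((a - m) ^ 2 / 2 * t / ε) * (2 * ε) =
    -((a - m) ^ 2 * t) by field_simp]
  have h1 : t * (a - m) ≤ μ - t * m - (ω₀ - t * ω₀) := by nlinarith
  have h2 : a - m ≤ μ - t * m + (ω₀ - t * ω₀) := by
    nlinarith [mul_nonneg (sub_nonneg.2 ht1) hω₀.le, mul_nonneg hm.le (sub_nonneg.2 ht1)]
  have h3 : 0 ≤ t * (a - m) := mul_nonneg ht0 (by linarith)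
  have h4 : 0 < a - m := by linarith
  nlinarith [mul_le_mul h1 h2 h4.le (h3.trans h1)]

/-- For `μ ≤ ω₀` the endpoint `τ = 0` dominates, and the kernel decays along the ray relative to
its value there. -/
lemma norm_saddleKernel_ray_mul_phaseExp_le {ε ω₀ m a μ t : ℝ} (hε : 0 < ε) (hm : 0 < m)
    (ha : m < a) (hμ : a ≤ μ) (hμω : μ ≤ ω₀) (ht0 : 0 ≤ t) (ht1 : t ≤ 1) :
    ‖saddleKernel ε ω₀ μ (t * (m + ω₀ * Complex.I)) * phaseExp ε ω₀ μ‖ ≤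
      Real.exp (-((a - m) ^ 2 / 2 * t / ε)) := by
  rw [norm_mul, norm_saddleKernel, norm_phaseExp, ← Real.exp_add, Real.exp_le_exp, ← add_div]
  simp
  rw [div_le_iff₀ (by positivity), show -((a - m) ^ 2 / 2 * t / ε) * (2 * ε) =
    -((a - m) ^ 2 * t) by field_simp]
  have h1 : μ * m ≤ ω₀ * m := mul_le_mul_of_nonneg_right hμω hm.le
  have h2 : t ^ 2 * (ω₀ ^ 2 - m ^ 2) ≤ t * (ω₀ ^ 2 - m ^ 2) := by
    refine mul_le_mul_of_nonneg_right (by nlinarith) ?_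
    nlinarith
  have h3 : (a - m) ^ 2 ≤ (ω₀ - m) ^ 2 := by
    refine pow_le_pow_left₀ ?_ ?_ 2 <;> linarith
  nlinarith [mul_le_mul_of_nonneg_left h1 ht0, mul_le_mul_of_nonneg_left h3 ht0]

lemma norm_saddleKernel_vertical_le {ε ω₀ μ₀ μ v : ℝ} (hε : 0 < ε) (hω₀ : 0 < ω₀)
    (hμ₀ : μ₀ ≤ -ω₀) (hv0 : 0 ≤ v) (hv1 : v ≤ ω₀) :
    ‖saddleKernel ε ω₀ μ (((μ - μ₀ : ℝ) : ℂ) + v * Complex.I)‖ ≤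
      Real.exp (-(ω₀ / 2 * v / ε)) := by
  rw [norm_saddleKernel, Real.exp_le_exp]
  simp
  rw [div_le_iff₀ (by positivity), show -(ω₀ / 2 * v / ε) * (2 * ε) = -(ω₀ * v) by field_simp]
  nlinarith

/-- The saddle point `τ = μ + iω₀` contributes `√(2π) G`; the endpoint `τ = 0` contributes `s`, which
is absorbed into `r` once `μ ≥ ω₀`. -/
theorem exists_saddle_decomposition {d : ℂ} {src : ℝ → ℝ} {ω₀ μ₀ m h : ℝ} {X : Set ℝ}
    {G : ℝ → ℂ → ℂ} (hω₀ : 0 < ω₀) (hμ₀ : μ₀ ≤ -ω₀) (hm : 0 < m) (hh : ω₀ < h)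
    (H : HeatContinuation d src (timeSector ω₀ m h) X G) {a : ℝ} (ha : m < a) (M : ℝ) :
    ∃ C > 0, ∀ ε : ℝ, 0 < ε → ∀ x ∈ X, ∀ μ ∈ Icc a M, ∃ r s : ℂ,
      ‖r‖ ≤ C * Real.sqrt ε ∧ ‖s‖ ≤ C * Real.sqrt ε ∧ (ω₀ ≤ μ → s = 0) ∧
      Ap ε d src ω₀ μ₀ x μ =
        ((Real.sqrt (2 * Real.pi) : ℂ) * G x ((μ : ℂ) + ω₀ * Complex.I) + r) * phaseExp ε ω₀ μ
          + s := by
  obtain ⟨K, hK, hKl⟩ := H.exists_lipschitz hω₀ hm hh ha M (M - μ₀) (by linarith)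
  obtain ⟨C₀, hC₀⟩ := H.bounded (|M - μ₀| + ω₀ + m)
  set CG := max C₀ 0 with hCG
  have hCG0 : 0 ≤ CG := le_max_right _ _
  have hGb : ∀ x ∈ X, ∀ τ ∈ timeSector ω₀ m h, ‖τ‖ ≤ |M - μ₀| + ω₀ + m → ‖G x τ‖ ≤ CG :=
    fun x hx τ hτ hn => (hC₀ x hx τ hτ hn).trans (le_max_left _ _)
  set p : ℂ := (m : ℂ) + ω₀ * Complex.I with hp
  set κ : ℝ := (a - m) ^ 2 / 2 with hκ
  have ham : 0 < a - m := by linarith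
  have hκ0 : 0 < κ := by positivity
  -- the Lipschitz constant is enlarged so that `hφ'` of `norm_laplace_sub_le` holds
  set K' : ℝ := K + K / (a - m) + K / ω₀ with hK'
  have hK'0 : 0 < K' := by positivity
  set C1 : ℝ := CG * ‖p‖ / κ with hC1
  set C2 : ℝ := CG / (ω₀ / 2) with hC2
  have hC1' : 0 ≤ C1 := by positivity
  have hC2' : 0 ≤ C2 := by positivity
  have hpn : ‖p‖ ≤ m + ω₀ := by
    refine (norm_add_le _ _).trans ?_
    simp [abs_of_pos hm, abs_of_pos hω₀]
  refine ⟨C1 + C2 + 2 * K', by positivity, ?_⟩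
  intro ε hε x hx μ hμ
  have hse : 0 < Real.sqrt ε := Real.sqrt_pos.2 hε
  have hse2 : Real.sqrt ε * Real.sqrt ε = ε := Real.mul_self_sqrt hε.le
  set L : ℝ := μ - μ₀ with hL
  have hLm : m ≤ L := by linarith [hμ.1]
  have hL0 : 0 < L := hm.trans_le hLm
  have hLM : L ≤ M - μ₀ := by linarith [hμ.2]
  have hLM' : L ≤ |M - μ₀| := hLM.trans (le_abs_self _)
  have hpm : p ∈ timeSector ω₀ m h := by
    refine ⟨fun h0 => ?_, ?_, ?_, ?_⟩
    · have := congrArg Complex.re h0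
      simp [hp] at this
      exact hm.ne' this
    · simpa [hp] using hω₀.le
    · simpa [hp] using hh.le
    · simp [hp, mul_comm]
  have hray : ∀ t ∈ Ioc (0 : ℝ) 1, (t : ℂ) * p ∈ timeSector ω₀ m h := by
    intro t ht
    obtain ⟨h0, h1, h2, h3⟩ := hpm
    refine ⟨mul_ne_zero (by exact_mod_cast ht.1.ne') h0, ?_, ?_, ?_⟩
    · simp [hp]; exact mul_nonneg ht.1.le hω₀.le
    · simp [hp]; nlinarith [ht.2]
    · simp [hp]; nlinarith [ht.1]
  have hvert : ∀ v ∈ Icc (0 : ℝ) ω₀, (L : ℂ) + v * Complex.I ∈ timeSector ω₀ m h := by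
    intro v hv
    refine ⟨fun h0 => ?_, by simpa using hv.1, by simpa using hv.2.trans hh.le, ?_⟩
    · have := congrArg Complex.re h0
      simp at this
      exact hL0.ne' this
    · simp
      rw [mul_comm ω₀]
      exact mul_le_mul hLm hv.2 hv.1 hL0.le
  have hline : ∀ u : ℝ, m ≤ u → (u : ℂ) + ω₀ * Complex.I ∈ timeSector ω₀ m h := by
    intro u hu
    refine ⟨fun h0 => ?_, by simpa using hω₀.le, by simpa using hh.le, ?_⟩
    · have := congrArg Complex.im h0
      simp at this
      exact hω₀.ne' this
    · simp; nlinarith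
  set f : ℂ → ℂ := fun τ => G x τ * saddleKernel ε ω₀ μ τ with hf
  have hfd : DifferentiableOn ℂ f (timeSector ω₀ m h) :=
    (H.analytic x hx).differentiableOn.mul (differentiable_saddleKernel ε ω₀ μ).differentiableOn
  obtain ⟨Ck, hCk⟩ := (isCompact_closedBall (0 : ℂ) (L + ω₀)).exists_bound_of_continuousOn
    (differentiable_saddleKernel ε ω₀ μ).continuous.continuousOn
  have hfb : ∀ z ∈ timeSector ω₀ m h, ‖z‖ ≤ L + ω₀ → ‖f z‖ ≤ CG * Ck := by
    intro z hz hn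
    rw [hf, norm_mul]
    exact mul_le_mul (hGb x hx z hz (by linarith)) (hCk z (by simpa using hn)) (norm_nonneg _) hCG0
  have hB : Bp ε d src ω₀ μ₀ x μ = (1 / (Real.sqrt ε : ℂ)) * ∫ τ in (0 : ℝ)..L, f τ := by
    rw [Bp_eq]
    congr 1
    refine intervalIntegral.integral_congr_ae (.of_forall fun τ hτ => ?_)
    rw [uIoc_of_le hL0.le] at hτ
    simp only [hf]
    rw [H.agrees x hx τ hτ.1 (ofReal_mem_timeSector hω₀ (hω₀.trans hh).le hτ.1)]
  rw [integral_eq_saddle_contour hm hω₀ hh.le hLm hfd hfb] at hB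
  set J1 : ℂ := ∫ t in (0 : ℝ)..1, f (t * p) * p with hJ1
  set J2 : ℂ := ∫ u in m..L, f (u + ω₀ * Complex.I) with hJ2
  set J3 : ℂ := ∫ v in (0 : ℝ)..ω₀, f (L + v * Complex.I) * Complex.I with hJ3
  have hfray : ∀ t ∈ Ioc (0 : ℝ) 1, ‖G x (t * p)‖ ≤ CG := by
    intro t ht
    refine hGb x hx _ (hray t ht) ?_
    rw [norm_mul, Complex.norm_real, Real.norm_of_nonneg ht.1.le]
    have : t * ‖p‖ ≤ 1 * ‖p‖ := mul_le_mul_of_nonneg_right ht.2 (norm_nonneg _)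
    linarith [abs_nonneg (M - μ₀)]
  have b3 : ‖J3‖ ≤ C2 * ε := by
    have := norm_integral_le_of_exp_decay (F := fun v : ℝ => f (L + v * Complex.I) * Complex.I)
      (κ := ω₀ / 2) hω₀.le hCG0 (by positivity) hε (fun v hv => by
        rw [norm_mul, Complex.norm_I, mul_one, hf, norm_mul]
        refine mul_le_mul ?_ (norm_saddleKernel_vertical_le hε hω₀ hμ₀ hv.1.le hv.2)
          (norm_nonneg _) hCG0
        refine hGb x hx _ (hvert v ⟨hv.1.le, hv.2⟩) ((norm_add_le _ _).trans ?_)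
        simp only [Complex.norm_real, norm_mul, Complex.norm_I, mul_one, Real.norm_eq_abs,
          abs_of_pos hL0, abs_of_pos hv.1]
        linarith [hv.2])
    refine this.trans (le_of_eq ?_)
    rw [hC2]; ring
  have b2 : ‖J2 - (Real.sqrt (2 * Real.pi) : ℂ) * Real.sqrt ε *
      G x ((μ : ℂ) + ω₀ * Complex.I)‖ ≤ K' * (2 * ε) := by
    have hμm : m ≤ μ := ha.le.trans hμ.1
    have := norm_laplace_sub_le (φ := fun u : ℝ => G x ((u : ℂ) + ω₀ * Complex.I))
      (φ₀ := G x ((μ : ℂ) + ω₀ * Complex.I)) (m := m) (L := L) (K := K') (μ := μ) hε hLm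
      ((H.analytic x hx).continuousOn.comp (by fun_prop) fun u hu => hline u hu.1)
      (fun u hu => ((hKl x hx μ hμ).2 u ⟨hu.1, hu.2.trans hLM⟩).trans (by
        refine mul_le_mul_of_nonneg_right ?_ (abs_nonneg _)
        have h1 : 0 < K / (a - m) := by positivity
        have h2 : 0 < K / ω₀ := by positivity
        linarith))
      (fun u hu => (hKl x hx μ hμ).1.trans (by
        rw [mem_Ioc, not_and_or, not_lt, not_le] at hu
        rcases hu with hu | hu
        · calc K = K / (a - m) * (a - m) := by field_simp
            _ ≤ K' * |μ - u| := by
              refine mul_le_mul ?_ (le_trans (by linarith [hμ.1]) (le_abs_self _)) ham.le hK'0.le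
              have h2 : 0 < K / ω₀ := by positivity
              linarith
        · calc K = K / ω₀ * ω₀ := by field_simp
            _ ≤ K' * |μ - u| := by
              refine mul_le_mul ?_ (le_trans (by linarith) (neg_le_abs _)) hω₀.le hK'0.le
              have h2 : 0 < K / (a - m) := by positivity
              linarith))
    simpa only [hJ2, hf, saddleKernel_line] using this
  have fin : ∀ J : ℂ, ∀ B : ℝ, ‖J‖ ≤ B * ε → ‖(1 / (Real.sqrt ε : ℂ)) * J‖ ≤ B * Real.sqrt ε := by
    intro J B hJ
    rw [norm_mul, norm_div, norm_one, Complex.norm_real, Real.norm_of_nonneg hse.le,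
      one_div_mul_eq_div, div_le_iff₀ hse, mul_assoc, hse2]
    exact hJ
  have hsc : (Real.sqrt ε : ℂ) ≠ 0 := by exact_mod_cast hse.ne'
  rcases le_or_gt ω₀ μ with hωμ | hωμ
  · have b1 : ‖J1‖ ≤ C1 * ε := by
      have := norm_integral_le_of_exp_decay (F := fun t : ℝ => f (t * p) * p)
        (K := CG * ‖p‖) zero_le_one (by positivity) hκ0 hε (fun t ht => by
          have h1 := norm_saddleKernel_ray_le hε hω₀ hm ha hμ.1 hωμ ht.1.le ht.2
          rw [show f (t * p) * p = G x (t * p) * p * saddleKernel ε ω₀ μ (t * p) by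
            simp only [hf]; ring, norm_mul, norm_mul]
          exact mul_le_mul (mul_le_mul_of_nonneg_right (hfray t ht) (norm_nonneg _)) h1
            (norm_nonneg _) (by positivity))
      refine this.trans (le_of_eq ?_)
      rw [hC1]; ring
    refine ⟨(1 / (Real.sqrt ε : ℂ)) * (J1 + (J2 - (Real.sqrt (2 * Real.pi) : ℂ) * Real.sqrt ε *
      G x ((μ : ℂ) + ω₀ * Complex.I)) - J3), 0, fin _ _ ?_, ?_, fun _ => rfl, ?_⟩
    · refine (norm_sub_le _ _).trans ?_
      linarith [norm_add_le J1 (J2 - (Real.sqrt (2 * Real.pi) : ℂ) * Real.sqrt ε *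
        G x ((μ : ℂ) + ω₀ * Complex.I))]
    · rw [norm_zero]; positivity
    · rw [Ap, hB]
      field_simp
      ring
  · have b1 : ‖J1 * phaseExp ε ω₀ μ‖ ≤ C1 * ε := by
      rw [hJ1, ← intervalIntegral.integral_mul_const]
      have := norm_integral_le_of_exp_decay
        (F := fun t : ℝ => f (t * p) * p * phaseExp ε ω₀ μ)
        (K := CG * ‖p‖) zero_le_one (by positivity) hκ0 hε (fun t ht => by
          have h1 := norm_saddleKernel_ray_mul_phaseExp_le hε hm ha hμ.1 hωμ.le ht.1.le ht.2
          rw [show f (t * p) * p * phaseExp ε ω₀ μ = G x (t * p) * p *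
            (saddleKernel ε ω₀ μ (t * p) * phaseExp ε ω₀ μ) by simp only [hf]; ring,
            norm_mul, norm_mul]
          exact mul_le_mul (mul_le_mul_of_nonneg_right (hfray t ht) (norm_nonneg _)) h1
            (norm_nonneg _) (by positivity))
      refine this.trans (le_of_eq ?_)
      rw [hC1]; ring
    refine ⟨(1 / (Real.sqrt ε : ℂ)) * ((J2 - (Real.sqrt (2 * Real.pi) : ℂ) * Real.sqrt ε *
      G x ((μ : ℂ) + ω₀ * Complex.I)) - J3), (1 / (Real.sqrt ε : ℂ)) * (J1 * phaseExp ε ω₀ μ),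
      fin _ _ ?_, fin _ _ ?_, fun hc => absurd hc hωμ.not_ge, ?_⟩
    · refine (norm_sub_le _ _).trans ?_
      have : 0 ≤ C1 * ε := by positivity
      linarith
    · have : 0 ≤ (C2 + 2 * K') * ε := by positivity
      linarith
    · rw [Ap, hB]
      field_simp
      ring

/-! ### From the decomposition to the buffer curve -/

/-- The particular solution is continuous in `μ`: after rescaling the Duhamel integral to `[0, 1]`
the integrand is dominated by a constant. -/
lemma HeatContinuation.continuousAt_Bp {d : ℂ} {src : ℝ → ℝ} {ω₀ m h : ℝ} {X : Set ℝ}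
    {G : ℝ → ℂ → ℂ} (hω₀ : 0 < ω₀) (hh : ω₀ < h)
    (H : HeatContinuation d src (timeSector ω₀ m h) X G) {x : ℝ} (hx : x ∈ X) {ε : ℝ}
    (hε : 0 < ε) {μ₀ μ₁ : ℝ} (hμ : μ₀ < μ₁) :
    ContinuousAt (fun μ => Bp ε d src ω₀ μ₀ x μ) μ₁ := by
  have hmem : ∀ t : ℝ, 0 < t → (t : ℂ) ∈ timeSector ω₀ m h :=
    fun t ht => ofReal_mem_timeSector hω₀ (hω₀.trans hh).le ht
  have hev : ∀ᶠ μ in nhds μ₁, μ ∈ Ioo μ₀ (μ₁ + 1) := Ioo_mem_nhds hμ (by linarith)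
  obtain ⟨C, hC⟩ := H.bounded (μ₁ + 1 - μ₀)
  have hcG : ∀ t : ℝ, 0 < t → ContinuousAt (G x) (t : ℂ) :=
    fun t ht => (H.analytic x hx _ (hmem t ht)).continuousAt
  have key : ContinuousAt (fun μ => (1 / (Real.sqrt ε : ℂ)) * (((μ - μ₀ : ℝ) : ℂ) *
      ∫ t in (0 : ℝ)..1, G x ((t * (μ - μ₀) : ℝ) : ℂ) *
        saddleKernel ε ω₀ μ ((t * (μ - μ₀) : ℝ) : ℂ))) μ₁ := by
    refine continuousAt_const.mul (ContinuousAt.mul (by fun_prop) ?_)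
    refine intervalIntegral.continuousAt_of_dominated_interval
      (bound := fun _ => C * Real.exp (ω₀ ^ 2 / (2 * ε))) ?_ ?_ (by simp) ?_
    · filter_upwards [hev] with μ hμ'
      rw [uIoc_of_le zero_le_one]
      refine ContinuousOn.aestronglyMeasurable (fun t ht => ?_) measurableSet_Ioc
      have ht' : 0 < t * (μ - μ₀) := mul_pos ht.1 (by linarith [hμ'.1])
      refine ContinuousAt.continuousWithinAt (ContinuousAt.mul ?_ ?_)
      · exact ContinuousAt.comp (f := fun t : ℝ => ((t * (μ - μ₀) : ℝ) : ℂ)) (hcG _ ht')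
          (by fun_prop)
      · exact ((differentiable_saddleKernel ε ω₀ μ).continuous.comp
          (f := fun t : ℝ => ((t * (μ - μ₀) : ℝ) : ℂ)) (by fun_prop)).continuousAt
    · filter_upwards [hev] with μ hμ'
      refine .of_forall fun t ht => ?_
      rw [uIoc_of_le zero_le_one] at ht
      have ht' : 0 < t * (μ - μ₀) := mul_pos ht.1 (by linarith [hμ'.1])
      rw [norm_mul]
      have h1 : ‖G x ((t * (μ - μ₀) : ℝ) : ℂ)‖ ≤ C := by
        refine hC x hx _ (hmem _ ht') ?_
        rw [Complex.norm_real, Real.norm_of_nonneg ht'.le]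
        nlinarith [ht.2, hμ'.1, hμ'.2]
      refine mul_le_mul h1 ?_ (norm_nonneg _) ((norm_nonneg _).trans h1)
      rw [norm_saddleKernel, Real.exp_le_exp]
      gcongr
      simp
      positivity
    · refine .of_forall fun t ht => ?_
      rw [uIoc_of_le zero_le_one] at ht
      have ht' : 0 < t * (μ₁ - μ₀) := mul_pos ht.1 (by linarith)
      refine ContinuousAt.mul ?_ ?_
      · exact ContinuousAt.comp (f := fun μ : ℝ => ((t * (μ - μ₀) : ℝ) : ℂ)) (hcG _ ht')
          (by fun_prop)
      · unfold saddleKernel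
        fun_prop
  refine key.congr ?_
  filter_upwards [hev] with μ hμ'
  have hL : 0 < μ - μ₀ := by linarith [hμ'.1]
  rw [Bp_eq]
  congr 1
  have h1 := intervalIntegral.integral_comp_mul_right (a := 0) (b := 1)
    (fun τ : ℝ => G x τ * saddleKernel ε ω₀ μ τ) hL.ne'
  rw [h1, zero_mul, one_mul, Complex.real_smul, ← mul_assoc, ← Complex.ofReal_mul,
    mul_inv_cancel₀ hL.ne', Complex.ofReal_one, one_mul]
  refine intervalIntegral.integral_congr_ae (.of_forall fun τ hτ => ?_)
  rw [uIoc_of_le hL.le] at hτ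
  rw [H.agrees x hx τ hτ.1 (hmem τ hτ.1)]

lemma HeatContinuation.continuousAt_Ap {d : ℂ} {src : ℝ → ℝ} {ω₀ m h : ℝ} {X : Set ℝ}
    {G : ℝ → ℂ → ℂ} (hω₀ : 0 < ω₀) (hh : ω₀ < h)
    (H : HeatContinuation d src (timeSector ω₀ m h) X G) {x : ℝ} (hx : x ∈ X) {ε : ℝ}
    (hε : 0 < ε) {μ₀ μ₁ : ℝ} (hμ : μ₀ < μ₁) :
    ContinuousAt (fun μ => Ap ε d src ω₀ μ₀ x μ) μ₁ := by
  unfold Ap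
  refine (H.continuousAt_Bp hω₀ hh hx hε hμ).mul ?_
  unfold phaseExp
  fun_prop

theorem particularAsymptotics_of_continuation {d : ℂ} {src : ℝ → ℝ} {ω₀ μ₀ m h : ℝ} {X : Set ℝ}
    {G : ℝ → ℂ → ℂ} (hω₀ : 0 < ω₀) (hμ₀ : μ₀ ≤ -ω₀) (hm : 0 < m) (hh : ω₀ < h)
    (H : HeatContinuation d src (timeSector ω₀ m h) X G) {a : ℝ} (ha : m < a) (M : ℝ) :
    ParticularAsymptotics d src ω₀ μ₀ X a M G := by
  obtain ⟨C, hC, hdec⟩ := exists_saddle_decomposition hω₀ hμ₀ hm hh H ha M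
  refine ⟨C, hC, 1, one_pos, fun ε hε _ x hx μ hμ hωμ => ?_⟩
  obtain ⟨r, s, hr, -, hs, hA⟩ := hdec ε hε x hx μ hμ
  exact ⟨r, hr, by rw [hA, hs hωμ, add_zero]⟩

lemma abs_log_sub_log_le {δ u v : ℝ} (hδ : 0 < δ) (hu : δ ≤ u) (hv : δ ≤ v) :
    |Real.log u - Real.log v| ≤ |u - v| / δ := by
  have key : ∀ p q : ℝ, δ ≤ p → δ ≤ q → Real.log p - Real.log q ≤ |p - q| / δ := by
    intro p q hp hq
    have hp0 := hδ.trans_le hp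
    have hq0 := hδ.trans_le hq
    rw [← Real.log_div hp0.ne' hq0.ne']
    calc Real.log (p / q) ≤ p / q - 1 := Real.log_le_sub_one_of_pos (by positivity)
      _ = (p - q) / q := by field_simp
      _ ≤ |p - q| / q := by gcongr; exact le_abs_self _
      _ ≤ |p - q| / δ := by gcongr
  rw [abs_le]
  have h1 := key u v hu hv
  have h2 := key v u hv hu
  rw [abs_sub_comm] at h2
  constructor <;> linarith

lemma one_le_sqrt_two_pi : 1 ≤ Real.sqrt (2 * Real.pi) := by
  rw [Real.one_le_sqrt]
  linarith [Real.pi_gt_three]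

lemma exists_forall_le_of_eventually {p : ℝ → Prop}
    (hp : ∀ᶠ ε in nhdsWithin (0 : ℝ) (Ioi 0), p ε) :
    ∃ ε₀ > 0, ∀ ε : ℝ, 0 < ε → ε ≤ ε₀ → p ε := by
  obtain ⟨u, hu, hsub⟩ := mem_nhdsGT_iff_exists_Ioc_subset.1 hp
  exact ⟨u, hu, fun ε h0 h1 => hsub ⟨h0, h1⟩⟩

lemma eventually_lt_of_continuous {f : ℝ → ℝ} (hf : Continuous f) {δ : ℝ} (h0 : f 0 < δ) :
    ∀ᶠ ε in nhdsWithin (0 : ℝ) (Ioi 0), f ε < δ :=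
  ((hf.tendsto 0).mono_left nhdsWithin_le_nhds).eventually_lt_const h0

theorem bufferCurveApprox_of_continuation {d : ℂ} {src : ℝ → ℝ} {ω₀ μ₀ m h : ℝ} {X : Set ℝ}
    {G : ℝ → ℂ → ℂ} (hω₀ : 0 < ω₀) (hμ₀ : μ₀ ≤ -ω₀) (hm : 0 < m) (hh : ω₀ < h)
    (H : HeatContinuation d src (timeSector ω₀ m h) X G) {a : ℝ} (ha : m < a) (M : ℝ) :
    BufferCurveApprox d src ω₀ μ₀ X a M G := by
  intro c hc
  obtain ⟨C, hC, hdec⟩ := exists_saddle_decomposition hω₀ hμ₀ hm hh H ha M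
  have hev : ∀ᶠ ε in nhdsWithin (0 : ℝ) (Ioi 0),
      C * Real.sqrt ε < 1 / 2 ∧ C * Real.sqrt ε < c / 2 :=
    (eventually_lt_of_continuous (by fun_prop) (by simp)).and
      (eventually_lt_of_continuous (by fun_prop) (by simpa using hc))
  obtain ⟨ε₀, hε₀, hsmall⟩ := exists_forall_le_of_eventually hev
  refine ⟨2 * (C / (c / 2) + C / (1 / 2)) + (C / c + C), by positivity, ε₀, hε₀, ?_⟩
  intro ε hε hεε x hx μ hμ hcG
  obtain ⟨hs1, hs2⟩ := hsmall ε hε hεε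
  obtain ⟨r, s, hr, hs, -, hA⟩ := hdec ε hε x hx μ hμ
  set g : ℂ := G x ((μ : ℂ) + ω₀ * Complex.I) with hg
  set P : ℝ := Real.exp ((μ ^ 2 - ω₀ ^ 2) / (2 * ε)) with hP
  have hP0 : 0 < P := Real.exp_pos _
  set Z : ℂ := (Real.sqrt (2 * Real.pi) : ℂ) * g + r with hZ
  set q : ℝ := Real.sqrt (2 * Real.pi) * ‖g‖ with hq
  have hg0 : 0 < ‖g‖ := hc.trans_le hcG
  have hqc : c ≤ q := by
    rw [hq]; nlinarith [one_le_sqrt_two_pi]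
  have hqn : ‖(Real.sqrt (2 * Real.pi) : ℂ) * g‖ = q := by rw [norm_mul, norm_sqrt_two_pi]
  have hZq : |q - ‖Z‖| ≤ C * Real.sqrt ε := by
    rw [← hqn]
    refine (abs_norm_sub_norm_le _ _).trans ?_
    rw [hZ, sub_add_cancel_left, norm_neg]
    exact hr
  have hAZ : |‖Ap ε d src ω₀ μ₀ x μ‖ - ‖Z‖ * P| ≤ C * Real.sqrt ε := by
    rw [hP, ← norm_phaseExp, ← norm_mul]
    refine (abs_norm_sub_norm_le _ _).trans ?_
    rw [hA, add_sub_cancel_left]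
    exact hs
  have hlogq : Real.log q = Real.log (2 * Real.pi) / 2 + Real.log ‖g‖ := by
    rw [hq, Real.log_mul sqrt_two_pi_pos.ne' hg0.ne', Real.log_sqrt (by positivity)]
  constructor
  · intro h1
    rw [h1] at hAZ
    have hZc : c / 2 ≤ ‖Z‖ := by linarith [(abs_le.1 hZq).2]
    have hZ0 : 0 < ‖Z‖ := by linarith
    have hw : 1 / 2 ≤ ‖Z‖ * P := by linarith [(abs_le.1 hAZ).2]
    have l1 : |Real.log q - Real.log ‖Z‖| ≤ C * Real.sqrt ε / (c / 2) :=
      (abs_log_sub_log_le (by positivity) (by linarith) hZc).trans (by gcongr)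
    have l2 : |Real.log (‖Z‖ * P)| ≤ C * Real.sqrt ε / (1 / 2) := by
      have := abs_log_sub_log_le (δ := 1 / 2) (by norm_num) (by norm_num : (1 : ℝ) / 2 ≤ 1) hw
      rw [Real.log_one, zero_sub, abs_neg] at this
      exact this.trans (by gcongr)
    rw [Real.log_mul hZ0.ne' hP0.ne', hP, Real.log_exp] at l2
    have l3 : μ ^ 2 - (ω₀ ^ 2 - ε * Real.log (2 * Real.pi) - 2 * ε * Real.log ‖g‖) =
        2 * ε * ((Real.log q - Real.log ‖Z‖) +
          (Real.log ‖Z‖ + (μ ^ 2 - ω₀ ^ 2) / (2 * ε))) := by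
      rw [hlogq]
      field_simp
      ring
    rw [l3, abs_mul, abs_of_pos (by positivity : 0 < 2 * ε)]
    calc 2 * ε * |_| ≤ 2 * ε * (C * Real.sqrt ε / (c / 2) + C * Real.sqrt ε / (1 / 2)) := by
          refine mul_le_mul_of_nonneg_left ((abs_add_le _ _).trans (add_le_add l1 l2)) ?_
          positivity
      _ = 2 * (C / (c / 2) + C / (1 / 2)) * (ε * Real.sqrt ε) := by ring
      _ ≤ _ := by
        gcongr
        have : 0 < C / c + C := by positivity
        linarith
  · intro h1
    rw [onBufferCurve_iff_norm, norm_mul, hqn, norm_phaseExp, ← hP] at h1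
    have hPc : P ≤ 1 / c := by
      rw [le_div_iff₀ hc]
      nlinarith
    have e1 : ‖Ap ε d src ω₀ μ₀ x μ‖ - 1 =
        (‖Ap ε d src ω₀ μ₀ x μ‖ - ‖Z‖ * P) - (q - ‖Z‖) * P := by rw [sub_mul, h1]; ring
    rw [e1]
    refine (abs_sub _ _).trans ?_
    rw [abs_mul, abs_of_pos hP0]
    calc _ ≤ C * Real.sqrt ε + C * Real.sqrt ε * (1 / c) := by gcongr
      _ = (C / c + C) * Real.sqrt ε := by ring
      _ ≤ _ := by
        refine mul_le_mul_of_nonneg_right ?_ (Real.sqrt_nonneg _)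
        have : 0 < 2 * (C / (c / 2) + C / (1 / 2)) := by positivity
        linarith

set_option maxHeartbeats 800000 in
/-- The defining function `μ² - ω₀² + ε ln 2π + 2ε ln|g|` of the buffer curve has slope at least `a`
for small `ε`, which turns the estimate of its value along `|A_p| = 1` into one for `μ`. -/
theorem bufferCurveLocated_of_continuation {d : ℂ} {src : ℝ → ℝ} {ω₀ μ₀ m h : ℝ} {X : Set ℝ}
    {G : ℝ → ℂ → ℂ} (hω₀ : 0 < ω₀) (hμ₀ : μ₀ ≤ -ω₀) (hm : 0 < m) (hh : ω₀ < h)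
    (H : HeatContinuation d src (timeSector ω₀ m h) X G) {a M : ℝ} (ha : m < a)
    (haω : a < ω₀) (hωM : ω₀ < M)
    (hlow : ∃ c > 0, ∀ x ∈ X, ∀ μ ∈ Icc a M, c ≤ ‖G x ((μ : ℂ) + ω₀ * Complex.I)‖) :
    BufferCurveLocated d src ω₀ μ₀ X a M G := by
  obtain ⟨c, hc, hcG⟩ := hlow
  obtain ⟨C, hC, hdec⟩ := exists_saddle_decomposition hω₀ hμ₀ hm hh H ha M
  obtain ⟨C₂, hC₂, ε₂, hε₂, happ⟩ :=
    bufferCurveApprox_of_continuation hω₀ hμ₀ hm hh H ha M c hc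
  obtain ⟨K, hK, hKl⟩ := H.exists_lipschitz hω₀ hm hh ha M M le_rfl
  have ha0 : 0 < a := hm.trans ha
  set S : ℝ := Real.sqrt (2 * Real.pi) with hS
  have hS1 : 1 ≤ S := one_le_sqrt_two_pi
  set B : ℝ := |Real.log c| + |Real.log K| with hB
  set D : ℝ := |Real.log (2 * Real.pi)| + 2 * B with hD
  have hδ1 : 0 < ω₀ ^ 2 - a ^ 2 := by nlinarith
  have hδ2 : 0 < M ^ 2 - ω₀ ^ 2 := by nlinarith
  have hev : ∀ᶠ ε in nhdsWithin (0 : ℝ) (Ioi 0), ε < ε₂ ∧ 2 * ε * (K / c) < a ∧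
      ε * D < ω₀ ^ 2 - a ^ 2 ∧ ε * D < M ^ 2 - ω₀ ^ 2 ∧
      C * Real.sqrt ε < 1 / 2 ∧ C * Real.sqrt ε < c / 2 ∧
      (S * K + C * Real.sqrt ε) * (2 * ε) < (ω₀ ^ 2 - a ^ 2) / 2 ∧
      2 * ε < c / 2 * (M ^ 2 - ω₀ ^ 2) := by
    refine (eventually_lt_of_continuous (by fun_prop) (by simpa)).and ?_
    refine (eventually_lt_of_continuous (by fun_prop) (by simpa)).and ?_
    refine (eventually_lt_of_continuous (by fun_prop) (by simpa using hδ1)).and ?_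
    refine (eventually_lt_of_continuous (by fun_prop) (by simpa using hδ2)).and ?_
    refine (eventually_lt_of_continuous (by fun_prop) (by simp)).and ?_
    refine (eventually_lt_of_continuous (by fun_prop) (by simpa using hc)).and ?_
    refine (eventually_lt_of_continuous (by fun_prop) (by simpa using hδ1)).and ?_
    exact eventually_lt_of_continuous (by fun_prop) (by rw [mul_zero]; positivity)
  obtain ⟨ε₀, hε₀, hsmall⟩ := exists_forall_le_of_eventually hev
  refine ⟨C₂ / a, by positivity, ε₀, hε₀, fun ε hε hεε x hx => ?_⟩
  obtain ⟨s1, s2, s3, s4, s5, s6, s7, s8⟩ := hsmall ε hε hεε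
  have haM : a ≤ M := by linarith
  set γ : ℝ → ℝ := fun μ => ‖G x ((μ : ℂ) + ω₀ * Complex.I)‖ with hγ
  have hγc : ∀ μ ∈ Icc a M, c ≤ γ μ := fun μ hμ => hcG x hx μ hμ
  have hγK : ∀ μ ∈ Icc a M, γ μ ≤ K := fun μ hμ => (hKl x hx μ hμ).1
  have hlip : ∀ μ ∈ Icc a M, ∀ ν ∈ Icc a M,
      |Real.log (γ μ) - Real.log (γ ν)| ≤ K / c * |μ - ν| := by
    intro μ hμ ν hν
    refine (abs_log_sub_log_le hc (hγc μ hμ) (hγc ν hν)).trans ?_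
    rw [div_mul_eq_mul_div]
    gcongr
    refine (abs_norm_sub_norm_le _ _).trans ?_
    have := (hKl x hx ν hν).2 μ ⟨ha.le.trans hμ.1, hμ.2⟩
    rwa [abs_sub_comm] at this
  have hlogB : ∀ μ ∈ Icc a M, |Real.log (γ μ)| ≤ B := by
    intro μ hμ
    have h1 := Real.log_le_log hc (hγc μ hμ)
    have h2 := Real.log_le_log (hc.trans_le (hγc μ hμ)) (hγK μ hμ)
    rw [abs_le, hB]
    constructor
    · linarith [neg_abs_le (Real.log c), abs_nonneg (Real.log K)]
    · linarith [le_abs_self (Real.log K), abs_nonneg (Real.log c)]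
  set Φ : ℝ → ℝ := fun μ =>
    μ ^ 2 - (ω₀ ^ 2 - ε * Real.log (2 * Real.pi) - 2 * ε * Real.log (γ μ)) with hΦ
  have hcurve : ∀ μ ∈ Icc a M,
      (OnBufferCurve ε ω₀ (G x ((μ : ℂ) + ω₀ * Complex.I)) μ ↔ Φ μ = 0) := by
    intro μ hμ
    rw [onBufferCurve_iff_sq hε, hΦ, sub_eq_zero]
    exact and_iff_right (norm_pos_iff.1 (hc.trans_le (hγc μ hμ)))
  have hmono : ∀ μ ∈ Icc a M, ∀ ν ∈ Icc a M, μ ≤ ν → a * (ν - μ) ≤ Φ ν - Φ μ := by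
    intro μ hμ ν hν hle
    have h1 := (abs_le.1 (hlip ν hν μ hμ)).1
    rw [abs_of_nonneg (sub_nonneg.2 hle)] at h1
    have h2 : 2 * ε * (-(K / c * (ν - μ))) ≤
        2 * ε * (Real.log (γ ν) - Real.log (γ μ)) :=
      mul_le_mul_of_nonneg_left h1 (by positivity)
    have h3 : 2 * ε * (K / c) * (ν - μ) ≤ a * (ν - μ) :=
      mul_le_mul_of_nonneg_right s2.le (sub_nonneg.2 hle)
    have h4 : (2 * a) * (ν - μ) ≤ ν ^ 2 - μ ^ 2 := by
      nlinarith [mul_nonneg (sub_nonneg.2 hle) (by linarith [hμ.1, hν.1] : 0 ≤ ν + μ - 2 * a)]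
    simp only [hΦ]
    nlinarith
  have habs : ∀ μ ∈ Icc a M, ∀ ν ∈ Icc a M, a * |μ - ν| ≤ |Φ μ - Φ ν| := by
    intro μ hμ ν hν
    rcases le_total μ ν with hle | hle
    · have := hmono μ hμ ν hν hle
      rw [abs_sub_comm, abs_sub_comm (Φ μ), abs_of_nonneg (sub_nonneg.2 hle)]
      exact this.trans (le_abs_self _)
    · have := hmono ν hν μ hμ hle
      rw [abs_of_nonneg (sub_nonneg.2 hle)]
      exact this.trans (le_abs_self _)
  have hγcont : ContinuousOn γ (Icc a M) := by
    refine ContinuousOn.norm ?_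
    refine (H.analytic x hx).continuousOn.comp (by fun_prop) fun μ hμ => ?_
    refine ⟨fun h0 => ?_, by simpa using hω₀.le, by simpa using hh.le, ?_⟩
    · have := congrArg Complex.im h0
      simp at this
      exact hω₀.ne' this
    · simp; nlinarith [hμ.1]
  have hΦcont : ContinuousOn Φ (Icc a M) := by
    have : ContinuousOn (fun μ => Real.log (γ μ)) (Icc a M) :=
      hγcont.log fun μ hμ => (hc.trans_le (hγc μ hμ)).ne'
    exact (by fun_prop : ContinuousOn (fun μ : ℝ => μ ^ 2) (Icc a M)).sub
      (continuousOn_const.sub (continuousOn_const.mul this))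
  have hDε : ∀ μ ∈ Icc a M, |Φ μ - (μ ^ 2 - ω₀ ^ 2)| ≤ ε * D := by
    intro μ hμ
    have h1 : Φ μ - (μ ^ 2 - ω₀ ^ 2) =
        ε * (Real.log (2 * Real.pi) + 2 * Real.log (γ μ)) := by simp only [hΦ]; ring
    rw [h1, abs_mul, abs_of_pos hε]
    refine mul_le_mul_of_nonneg_left ((abs_add_le _ _).trans ?_) hε.le
    rw [abs_mul, abs_two]
    linarith [hlogB μ hμ]
  have haI : a ∈ Icc a M := left_mem_Icc.2 haM
  have hMI : M ∈ Icc a M := right_mem_Icc.2 haM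
  obtain ⟨ν, hν, hν0⟩ : ∃ ν ∈ Icc a M, Φ ν = 0 := by
    refine intermediate_value_Icc haM hΦcont ⟨?_, ?_⟩
    · linarith [(abs_le.1 (hDε a haI)).2]
    · linarith [(abs_le.1 (hDε M hMI)).1]
  refine ⟨ν, hν, (hcurve ν hν).2 hν0, fun ν' hν' hb => ?_, ?_, fun μ hμ h1 => ?_⟩
  · have h1 := habs ν' hν' ν hν
    rw [(hcurve ν' hν').1 hb, hν0, sub_zero, abs_zero] at h1
    have h2 : |ν' - ν| ≤ 0 := by nlinarith [abs_nonneg (ν' - ν)]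
    exact sub_eq_zero.1 (abs_nonpos_iff.1 h2)
  · have hcontA : ContinuousOn (fun μ => ‖Ap ε d src ω₀ μ₀ x μ‖) (Icc a M) := by
      intro μ hμ
      exact (H.continuousAt_Ap hω₀ hh hx hε (by linarith [hμ.1])).norm.continuousWithinAt
    refine intermediate_value_Icc haM hcontA ⟨?_, ?_⟩
    · obtain ⟨r, s, hr, hs, -, hA⟩ := hdec ε hε x hx a haI
      rw [hA]
      refine (norm_add_le _ _).trans ?_
      rw [norm_mul, norm_phaseExp]
      have h1 : ‖(Real.sqrt (2 * Real.pi) : ℂ) * G x ((a : ℂ) + ω₀ * Complex.I) + r‖ ≤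
          S * K + C * Real.sqrt ε := by
        refine (norm_add_le _ _).trans (add_le_add ?_ hr)
        rw [norm_mul, norm_sqrt_two_pi]
        exact mul_le_mul_of_nonneg_left (hγK a haI) (by linarith)
      -- `exp(-y) ≤ 1/y` makes the saddle contribution small at `μ = a < ω₀`
      have h2 : Real.exp ((a ^ 2 - ω₀ ^ 2) / (2 * ε)) ≤ (2 * ε) / (ω₀ ^ 2 - a ^ 2) := by
        have h3 : (a ^ 2 - ω₀ ^ 2) / (2 * ε) = -((ω₀ ^ 2 - a ^ 2) / (2 * ε)) := by ring
        rw [h3, Real.exp_neg, ← inv_div (ω₀ ^ 2 - a ^ 2) (2 * ε)]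
        have h5 : 0 < (ω₀ ^ 2 - a ^ 2) / (2 * ε) := by positivity
        refine inv_anti₀ h5 ?_
        linarith [Real.add_one_le_exp ((ω₀ ^ 2 - a ^ 2) / (2 * ε))]
      have h6 : (S * K + C * Real.sqrt ε) * ((2 * ε) / (ω₀ ^ 2 - a ^ 2)) ≤ 1 / 2 := by
        rw [← mul_div_assoc, div_le_iff₀ hδ1]
        linarith
      have h7 := mul_le_mul h1 h2 (Real.exp_pos _).le ((norm_nonneg _).trans h1)
      linarith
    · obtain ⟨r, s, hr, -, hs, hA⟩ := hdec ε hε x hx M hMI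
      rw [hA, hs hωM.le, add_zero, norm_mul, norm_phaseExp]
      have h1 : c / 2 ≤ ‖(Real.sqrt (2 * Real.pi) : ℂ) * G x ((M : ℂ) + ω₀ * Complex.I) + r‖ := by
        have h2 : c ≤ ‖(Real.sqrt (2 * Real.pi) : ℂ) * G x ((M : ℂ) + ω₀ * Complex.I)‖ := by
          rw [norm_mul, norm_sqrt_two_pi]
          have := hγc M hMI
          simp only [hγ] at this
          nlinarith
        have h3 := norm_sub_le_norm_add
          ((Real.sqrt (2 * Real.pi) : ℂ) * G x ((M : ℂ) + ω₀ * Complex.I)) r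
        linarith
      have h4 : (M ^ 2 - ω₀ ^ 2) / (2 * ε) ≤ Real.exp ((M ^ 2 - ω₀ ^ 2) / (2 * ε)) := by
        linarith [Real.add_one_le_exp ((M ^ 2 - ω₀ ^ 2) / (2 * ε))]
      have h5 : 1 ≤ c / 2 * ((M ^ 2 - ω₀ ^ 2) / (2 * ε)) := by
        rw [← mul_div_assoc, le_div_iff₀ (by positivity)]
        linarith
      exact h5.trans (mul_le_mul h1 h4 (by positivity) (by positivity))
  · have h2 := (happ ε hε s1.le x hx μ hμ (hγc μ hμ)).1 h1
    have h3 := habs μ hμ ν hν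
    rw [hν0, sub_zero] at h3
    rw [div_mul_eq_mul_div, le_div_iff₀ ha0]
    calc |μ - ν| * a = a * |μ - ν| := mul_comm _ _
      _ ≤ |Φ μ| := h3
      _ ≤ _ := h2

/-! ### The heat-kernel convolution of a bounded source at complex times -/

lemma inv_re_pos {z : ℂ} (hz : 0 < z.re) : 0 < (z⁻¹).re := by
  rw [Complex.inv_re]
  exact div_pos hz (Complex.normSq_pos.2 fun h => by simp [h] at hz)

lemma norm_heatKernel (x y : ℝ) (z : ℂ) :
    ‖Complex.exp (-((x : ℂ) - y) ^ 2 / z)‖ = Real.exp (-(z⁻¹).re * (x - y) ^ 2) := by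
  have : -((x : ℂ) - y) ^ 2 / z = -z⁻¹ * ((x - y : ℝ) : ℂ) ^ 2 := by
    push_cast
    rw [div_eq_mul_inv]; ring
  rw [this, norm_cexp_neg_mul_sq]

lemma integrable_heatKernel (x : ℝ) {z : ℂ} (hz : 0 < z.re) :
    Integrable fun y : ℝ => Complex.exp (-((x : ℂ) - y) ^ 2 / z) := by
  have h := (integrable_cexp_neg_mul_sq (inv_re_pos hz)).comp_sub_left x
  refine h.congr (.of_forall fun y => ?_)
  simp only
  congr 1
  push_cast
  rw [div_eq_mul_inv]; ring

lemma integrable_heatKernel_mul (x : ℝ) {z : ℂ} (hz : 0 < z.re) {src : ℝ → ℝ}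
    (hs : Measurable src) {B : ℝ} (hB : ∀ y, |src y| ≤ B) :
    Integrable fun y : ℝ => Complex.exp (-((x : ℂ) - y) ^ 2 / z) * (src y : ℂ) :=
  (integrable_heatKernel x hz).mul_bdd (c := B)
    (Complex.measurable_ofReal.comp hs).aestronglyMeasurable
    (.of_forall fun y => by simpa using hB y)

lemma norm_heatConv_le {d τ : ℂ} (hτ : 0 < (d * τ).re) {src : ℝ → ℝ} {B : ℝ}
    (hB : ∀ y, |src y| ≤ B) (x : ℝ) :
    ‖heatConv d src x τ‖ ≤ B * Real.sqrt (‖d * τ‖ / (d * τ).re) := by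
  set w : ℂ := d * τ with hw
  have hB0 : 0 ≤ B := (abs_nonneg _).trans (hB 0)
  have hw0 : 0 < ‖w‖ := norm_pos_iff.2 fun h => by simp [h] at hτ
  have e1 : 4 * (Real.pi : ℂ) * d * τ = ((4 * Real.pi : ℝ) : ℂ) * w := by
    rw [hw]; push_cast; ring
  have e2 : 4 * d * τ = 4 * w := by rw [hw]; ring
  have h4 : 0 < (4 * w).re := by simpa using hτ
  have hb := inv_re_pos h4
  have hI : ‖∫ y : ℝ, Complex.exp (-((x : ℂ) - y) ^ 2 / (4 * w)) * (src y : ℂ)‖ ≤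
      B * Real.sqrt (Real.pi / ((4 * w)⁻¹).re) := by
    rw [← integral_gaussian, ← integral_const_mul]
    rw [← integral_sub_left_eq_self (fun y : ℝ => B * Real.exp (-((4 * w)⁻¹).re * y ^ 2)) volume x]
    refine norm_integral_le_of_norm_le
      (((integrable_exp_neg_mul_sq hb).const_mul B).comp_sub_left x) (.of_forall fun y => ?_)
    rw [norm_mul, norm_heatKernel, mul_comm]
    refine mul_le_mul_of_nonneg_right ?_ (Real.exp_pos _).le
    simpa using hB y
  have hp : ‖(1 / (4 * (Real.pi : ℂ) * d * τ) ^ (1 / 2 : ℂ))‖ =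
      (Real.sqrt (4 * Real.pi * ‖w‖))⁻¹ := by
    rw [e1, norm_div, norm_one, show (1 / 2 : ℂ) = ((1 / 2 : ℝ) : ℂ) by push_cast; rfl,
      Complex.norm_cpow_real, ← Real.sqrt_eq_rpow, norm_mul, Complex.norm_real,
      Real.norm_of_nonneg (by positivity), one_div]
  rw [heatConv, norm_mul, hp, e2]
  refine (mul_le_mul_of_nonneg_left hI (by positivity)).trans_eq ?_
  rw [mul_left_comm, ← Real.sqrt_inv, ← Real.sqrt_mul (by positivity)]
  congr 2
  rw [Complex.inv_re, Complex.normSq_eq_norm_sq]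
  have : (4 * w).re = 4 * w.re := by simp
  clear_value w
  rw [this, norm_mul, Complex.norm_ofNat]
  field_simp

lemma differentiableAt_integral_heatKernel_mul (x : ℝ) {z₀ : ℂ} (hz₀ : 0 < z₀.re) {src : ℝ → ℝ}
    (hs : Measurable src) {B : ℝ} (hB : ∀ y, |src y| ≤ B) :
    DifferentiableAt ℂ
      (fun z => ∫ y : ℝ, Complex.exp (-((x : ℂ) - y) ^ 2 / z) * (src y : ℂ)) z₀ := by
  have hb := inv_re_pos hz₀
  set b : ℝ := (z₀⁻¹).re with hbdef
  have hB0 : 0 ≤ B := (abs_nonneg _).trans (hB 0)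
  have hsm : AEStronglyMeasurable (fun y : ℝ => (src y : ℂ)) volume :=
    (Complex.measurable_ofReal.comp hs).aestronglyMeasurable
  have hcont : ∀ β : ℂ, Continuous fun y : ℝ => Complex.exp (-β * ((x : ℂ) - y) ^ 2) :=
    fun β => by fun_prop
  have hint : Integrable fun y : ℝ =>
      B * ((x - y) ^ 2 * Real.exp (-(b / 2) * (x - y) ^ 2)) := by
    have h := integrable_rpow_mul_exp_neg_mul_sq (b := b / 2) (by positivity)
      (s := 2) (by norm_num)
    simp only [Real.rpow_two] at h
    exact (h.comp_sub_left x).const_mul B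
  have key := (hasDerivAt_integral_of_dominated_loc_of_deriv_le (𝕜 := ℂ) (μ := volume)
    (F := fun (β : ℂ) (y : ℝ) => Complex.exp (-β * ((x : ℂ) - y) ^ 2) * (src y : ℂ))
    (F' := fun (β : ℂ) (y : ℝ) =>
      Complex.exp (-β * ((x : ℂ) - y) ^ 2) * (-((x : ℂ) - y) ^ 2) * (src y : ℂ))
    (x₀ := z₀⁻¹) (s := {β : ℂ | b / 2 < β.re})
    (bound := fun y => B * ((x - y) ^ 2 * Real.exp (-(b / 2) * (x - y) ^ 2)))
    ((isOpen_lt continuous_const Complex.continuous_re).mem_nhds (by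
      change b / 2 < (z₀⁻¹).re
      linarith))
    (.of_forall fun β => (hcont β).aestronglyMeasurable.mul hsm)
    (by
      have := integrable_heatKernel_mul x hz₀ hs hB
      refine this.congr (.of_forall fun y => ?_)
      simp only
      rw [div_eq_mul_inv]
      ring_nf)
    (((hcont _).mul (by fun_prop)).aestronglyMeasurable.mul hsm)
    (.of_forall fun y β hβ => by
      have e : (x : ℂ) - y = ((x - y : ℝ) : ℂ) := by push_cast; rfl
      rw [norm_mul, norm_mul, e, norm_cexp_neg_mul_sq, norm_neg, norm_pow, Complex.norm_real,
        Real.norm_eq_abs, sq_abs, Complex.norm_real, Real.norm_eq_abs]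
      have h1 : Real.exp (-β.re * (x - y) ^ 2) ≤ Real.exp (-(b / 2) * (x - y) ^ 2) := by
        rw [Real.exp_le_exp]
        have : b / 2 < β.re := hβ
        nlinarith [sq_nonneg (x - y)]
      calc _ ≤ Real.exp (-(b / 2) * (x - y) ^ 2) * (x - y) ^ 2 * B := by
            gcongr
            exact hB y
        _ = _ := by ring)
    hint
    (.of_forall fun y β _ => by
      have h1 : HasDerivAt (fun β : ℂ => -β * ((x : ℂ) - y) ^ 2) (-((x : ℂ) - y) ^ 2) β := by
        simpa using ((hasDerivAt_id β).neg.mul_const (((x : ℂ) - y) ^ 2))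
      exact h1.cexp.mul_const _)).2.differentiableAt
  have hz0 : z₀ ≠ 0 := fun h => by simp [h] at hz₀
  have := key.comp z₀ (differentiableAt_inv hz0)
  refine this.congr_of_eventuallyEq (.of_forall fun z => ?_)
  simp only [Function.comp_apply]
  congr 1
  ext y
  rw [div_eq_mul_inv]
  ring_nf

lemma differentiableAt_heatConv {d τ : ℂ} (hτ : 0 < (d * τ).re) {src : ℝ → ℝ}
    (hs : Measurable src) {B : ℝ} (hB : ∀ y, |src y| ≤ B) (x : ℝ) :
    DifferentiableAt ℂ (heatConv d src x) τ := by
  have h4 : 0 < (4 * d * τ).re := by rw [mul_assoc]; simpa using hτ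
  have hsl : 4 * (Real.pi : ℂ) * d * τ ∈ Complex.slitPlane := by
    left
    have : 4 * (Real.pi : ℂ) * d * τ = ((4 * Real.pi : ℝ) : ℂ) * (d * τ) := by push_cast; ring
    rw [this, Complex.re_ofReal_mul]
    positivity
  have h1 : DifferentiableAt ℂ
      (fun τ : ℂ => ∫ y : ℝ, Complex.exp (-((x : ℂ) - y) ^ 2 / (4 * d * τ)) * (src y : ℂ)) τ :=
    (differentiableAt_integral_heatKernel_mul x h4 hs hB).comp τ
      (f := fun τ : ℂ => 4 * d * τ) (by fun_prop)
  have h2 : DifferentiableAt ℂ (fun τ : ℂ => 1 / (4 * (Real.pi : ℂ) * d * τ) ^ (1 / 2 : ℂ)) τ := by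
    refine (differentiableAt_const _).div (DifferentiableAt.cpow (by fun_prop) (by fun_prop) hsl) ?_
    rw [Ne, Complex.cpow_eq_zero_iff]
    exact fun h => Complex.slitPlane_ne_zero hsl h.1
  exact h2.mul h1

/-- A bounded source needs no continuation: if the boundary ray of the sector stays in the
half-plane `Re (dτ) > 0`, then the convolution integral is analytic on the sector, and bounded
because `|dτ| / Re (dτ)` is. -/
theorem heatContinuation_heatConv {d : ℂ} (hd : 0 < d.re) {ω₀ m : ℝ} (hω₀ : 0 < ω₀)
    (hdm : 0 < (d * ((m : ℂ) + ω₀ * Complex.I)).re) (h : ℝ) {src : ℝ → ℝ}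
    (hs : Measurable src) {B : ℝ} (hB : ∀ y, |src y| ≤ B) (X : Set ℝ) :
    HeatContinuation d src (timeSector ω₀ m h) X (heatConv d src) := by
  set p : ℂ := d * ((m : ℂ) + ω₀ * Complex.I) with hp
  have hB0 : 0 ≤ B := (abs_nonneg _).trans (hB 0)
  have hd0 : 0 < ‖d‖ := norm_pos_iff.2 fun h => by simp [h] at hd
  have hp0 : 0 < ‖p‖ := norm_pos_iff.2 fun h => by rw [h] at hdm; simp at hdm
  set κ : ℝ := min (d.re / ‖d‖) (p.re / ‖p‖) with hκ
  have hκ0 : 0 < κ := lt_min (by positivity) (by positivity)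
  have hκd : κ * ‖d‖ ≤ d.re := (le_div_iff₀ hd0).1 (min_le_left _ _)
  have hκp : κ * ‖p‖ ≤ p.re := (le_div_iff₀ hp0).1 (min_le_right _ _)
  -- `τ` is a nonnegative combination of `1` and `m + iω₀`
  have hsec : ∀ τ ∈ timeSector ω₀ m h, κ * ‖d * τ‖ ≤ (d * τ).re := by
    rintro τ ⟨-, h1, -, h3⟩
    set β : ℝ := τ.im / ω₀ with hβ
    set α : ℝ := τ.re - m * β with hα
    have hβ0 : 0 ≤ β := by positivity
    have hβω : β * ω₀ = τ.im := by rw [hβ]; field_simp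
    have hα0 : 0 ≤ α := by
      rw [hα, hβ, ← mul_div_assoc, sub_nonneg, div_le_iff₀ hω₀]
      linarith
    have e : d * τ = (α : ℂ) * d + (β : ℂ) * p := by
      have : τ = (α : ℂ) + β * ((m : ℂ) + ω₀ * Complex.I) := by
        apply Complex.ext
        · simp [hα]; ring
        · simp [hβω]
      rw [hp]
      conv_lhs => rw [this]
      ring
    rw [e, Complex.add_re, Complex.re_ofReal_mul, Complex.re_ofReal_mul]
    have h5 : ‖(α : ℂ) * d + (β : ℂ) * p‖ ≤ α * ‖d‖ + β * ‖p‖ := by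
      refine (norm_add_le _ _).trans ?_
      rw [norm_mul, norm_mul, Complex.norm_real, Complex.norm_real, Real.norm_of_nonneg hα0,
        Real.norm_of_nonneg hβ0]
    calc _ ≤ κ * (α * ‖d‖ + β * ‖p‖) := by gcongr
      _ = α * (κ * ‖d‖) + β * (κ * ‖p‖) := by ring
      _ ≤ _ := by gcongr
  have hre : ∀ τ ∈ timeSector ω₀ m h, 0 < (d * τ).re := by
    intro τ hτ
    refine lt_of_lt_of_le ?_ (hsec τ hτ)
    exact mul_pos hκ0 (norm_pos_iff.2 (mul_ne_zero (norm_pos_iff.1 hd0) hτ.1))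
  refine ⟨fun x _ t ht => ?_, fun x _ τ hτ => ?_, fun _ _ _ _ _ => rfl, fun L => ?_⟩
  · refine integrable_heatKernel_mul x ?_ hs hB
    simp only [Complex.mul_re, Complex.ofReal_re, Complex.ofReal_im, Complex.re_ofNat,
      Complex.im_ofNat]
    simp
    positivity
  · have ho : IsOpen {τ : ℂ | 0 < (d * τ).re} :=
      isOpen_lt continuous_const (by fun_prop)
    have hdo : DifferentiableOn ℂ (heatConv d src x) {τ : ℂ | 0 < (d * τ).re} :=
      fun τ hτ => (differentiableAt_heatConv hτ hs hB x).differentiableWithinAt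
    exact hdo.analyticOnNhd ho τ (hre τ hτ)
  · refine ⟨B * Real.sqrt (1 / κ), fun x _ τ hτ _ => ?_⟩
    refine (norm_heatConv_le (hre τ hτ) hB x).trans ?_
    refine mul_le_mul_of_nonneg_left (Real.sqrt_le_sqrt ?_) hB0
    rw [div_le_div_iff₀ (hre τ hτ) hκ0]
    linarith [hsec τ hτ]

/-! ### Square roots off the negative axis -/

lemma mul_mem_slitPlane {d τ : ℂ} (hd : 0 < d.re) (hτ : 0 < τ.re) : d * τ ∈ Complex.slitPlane := by
  rw [Complex.mem_slitPlane_iff]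
  by_contra! hcon
  obtain ⟨h1, h2⟩ := hcon
  rw [Complex.mul_re] at h1
  rw [Complex.mul_im] at h2
  have h3 : d.im = -(d.re * τ.im / τ.re) := by field_simp; linarith
  rw [h3] at h1
  have h4 : 0 ≤ d.re * τ.im / τ.re * τ.im := by
    have : d.re * τ.im / τ.re * τ.im = d.re * τ.im ^ 2 / τ.re := by ring
    rw [this]; positivity
  nlinarith [mul_pos hd hτ]

lemma add_ofReal_mem_slitPlane {w : ℂ} (hw : w = 0 ∨ w ∈ Complex.slitPlane) {σ : ℝ} (hσ : 0 < σ) :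
    w + σ ∈ Complex.slitPlane := by
  rw [Complex.mem_slitPlane_iff] at *
  rcases hw with rfl | hw | hw
  · left; simpa using hσ
  · left; simp; linarith
  · right; simpa using hw

lemma ofReal_div_mem_slitPlane {w : ℂ} (hw : w ∈ Complex.slitPlane) {σ : ℝ} (hσ : 0 < σ) :
    (σ : ℂ) / w ∈ Complex.slitPlane := by
  have hn : 0 < Complex.normSq w := Complex.normSq_pos.2 (Complex.slitPlane_ne_zero hw)
  rw [Complex.mem_slitPlane_iff] at *
  rw [div_eq_mul_inv, Complex.re_ofReal_mul, Complex.im_ofReal_mul, Complex.inv_re, Complex.inv_im]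
  rcases hw with hw | hw
  · left; positivity
  · right
    exact mul_ne_zero hσ.ne' (div_ne_zero (neg_ne_zero.2 hw) hn.ne')

lemma cpow_half_sq (z : ℂ) : (z ^ (1 / 2 : ℂ)) ^ 2 = z := by
  have := Complex.cpow_ofNat_inv_pow z 2
  rwa [← one_div] at this

/-- The principal roots multiply, since `w` and `σ / (w + σ)` lie in opposite closed half-planes. -/
lemma cpow_half_mul_div_add {w : ℂ} {c σ : ℝ} (hc : 0 < c) (hσ : 0 < σ)
    (hw : w ∈ Complex.slitPlane) :
    ((c : ℂ) * w * (σ / (w + σ))) ^ (1 / 2 : ℂ) =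
      ((c : ℂ) * w) ^ (1 / 2 : ℂ) * (σ / (w + σ)) ^ (1 / 2 : ℂ) := by
  have hwσ : w + σ ≠ 0 := Complex.slitPlane_ne_zero (add_ofReal_mem_slitPlane (.inr hw) hσ)
  have h1 : (c : ℂ) * w ≠ 0 :=
    mul_ne_zero (by exact_mod_cast hc.ne') (Complex.slitPlane_ne_zero hw)
  have h2 : (σ : ℂ) / (w + σ) ≠ 0 := div_ne_zero (by exact_mod_cast hσ.ne') hwσ
  have hn : 0 < Complex.normSq (w + σ) := Complex.normSq_pos.2 hwσ
  have him : ((σ : ℂ) / (w + σ)).im = -(σ * w.im / Complex.normSq (w + σ)) := by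
    rw [div_eq_mul_inv, Complex.im_ofReal_mul, Complex.inv_im]
    simp
    ring
  have harg : ((c : ℂ) * w).arg + ((σ : ℂ) / (w + σ)).arg ∈ Ioc (-Real.pi) Real.pi := by
    rcases le_or_gt 0 w.im with h | h
    · have a1 : 0 ≤ ((c : ℂ) * w).arg := by
        rw [Complex.arg_nonneg_iff, Complex.im_ofReal_mul]; positivity
      have a2 : ((σ : ℂ) / (w + σ)).arg ≤ 0 ∨ w.im = 0 := by
        rcases h.eq_or_lt with h | h
        · exact Or.inr h.symm
        · left
          refine (Complex.arg_neg_iff.2 ?_).le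
          rw [him, neg_lt_zero]; positivity
      have a3 := Complex.neg_pi_lt_arg ((σ : ℂ) / (w + σ))
      have a4 := Complex.arg_le_pi ((c : ℂ) * w)
      rcases a2 with a2 | a2
      · exact ⟨by linarith, by linarith⟩
      · have hre : 0 < w.re := by
          rcases Complex.mem_slitPlane_iff.1 hw with h0 | h0
          · exact h0
          · exact absurd a2 h0
        have a5 : ((c : ℂ) * w).arg = 0 := by
          rw [Complex.arg_eq_zero_iff, Complex.re_ofReal_mul, Complex.im_ofReal_mul, a2, mul_zero]
          exact ⟨by positivity, rfl⟩
        rw [a5, zero_add]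
        exact ⟨a3, Complex.arg_le_pi _⟩
    · have a1 : ((c : ℂ) * w).arg < 0 := by
        rw [Complex.arg_neg_iff, Complex.im_ofReal_mul]; exact mul_neg_of_pos_of_neg hc h
      have a2 : 0 ≤ ((σ : ℂ) / (w + σ)).arg := by
        rw [Complex.arg_nonneg_iff, him, neg_nonneg]
        exact div_nonpos_of_nonpos_of_nonneg (mul_nonpos_of_nonneg_of_nonpos hσ.le h.le) hn.le
      have a3 := Complex.neg_pi_lt_arg ((c : ℂ) * w)
      have a4 := Complex.arg_le_pi ((σ : ℂ) / (w + σ))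
      exact ⟨by linarith, by linarith⟩
  rw [Complex.cpow_def_of_ne_zero (mul_ne_zero h1 h2), Complex.cpow_def_of_ne_zero h1,
    Complex.cpow_def_of_ne_zero h2, (Complex.log_mul_eq_add_log_iff h1 h2).2 harg, add_mul,
    Complex.exp_add]

/-! ### Gaussian sources -/

lemma gaussian_convolution {w : ℂ} (hw : w ∈ Complex.slitPlane) {σ : ℝ} (hσ : 0 < σ)
    (hre : 0 < ((w + σ) / w).re) (x : ℝ) :
    (1 / (4 * (Real.pi : ℂ) * w) ^ (1 / 2 : ℂ)) *
      ∫ y : ℝ, Complex.exp (-((x : ℂ) - y) ^ 2 / (4 * w)) * (gaussSource σ y : ℂ) =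
    ((σ : ℂ) / (w + σ)) ^ (1 / 2 : ℂ) * Complex.exp (-(x : ℂ) ^ 2 / (4 * (w + σ))) := by
  have hw0 : w ≠ 0 := Complex.slitPlane_ne_zero hw
  have hwσ : w + σ ≠ 0 := Complex.slitPlane_ne_zero (add_ofReal_mem_slitPlane (.inr hw) hσ)
  have hσ0 : (σ : ℂ) ≠ 0 := by exact_mod_cast hσ.ne'
  set b : ℂ := -((w + σ) / (4 * w * σ)) with hb
  have hbre : b.re < 0 := by
    have : b = -(((w + σ) / w) / ((4 * σ : ℝ) : ℂ)) := by
      rw [hb]; push_cast; field_simp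
    rw [this, Complex.neg_re, Complex.div_ofReal_re, neg_lt_zero]
    positivity
  have hI : ∀ y : ℝ, Complex.exp (-((x : ℂ) - y) ^ 2 / (4 * w)) * (gaussSource σ y : ℂ) =
      Complex.exp (b * (y : ℂ) ^ 2 + (x / (2 * w)) * y + -(x : ℂ) ^ 2 / (4 * w)) := by
    intro y
    rw [gaussSource]
    push_cast
    rw [← Complex.exp_add]
    congr 1
    rw [hb]
    field_simp
    ring
  simp only [hI]
  rw [integral_cexp_quadratic hbre]
  have hpb : (Real.pi : ℂ) / -b = ((4 * Real.pi : ℝ) : ℂ) * w * (σ / (w + σ)) := by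
    rw [hb]; push_cast; field_simp
  have hexp : -(x : ℂ) ^ 2 / (4 * w) - (x / (2 * w)) ^ 2 / (4 * b) =
      -(x : ℂ) ^ 2 / (4 * (w + σ)) := by
    rw [hb]; field_simp; ring
  rw [hpb, hexp, cpow_half_mul_div_add (by positivity) hσ hw]
  have h4 : 4 * (Real.pi : ℂ) * w = ((4 * Real.pi : ℝ) : ℂ) * w := by push_cast; rfl
  rw [h4]
  have hne : (((4 * Real.pi : ℝ) : ℂ) * w) ^ (1 / 2 : ℂ) ≠ 0 := by
    rw [Ne, Complex.cpow_eq_zero_iff]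
    refine fun h => mul_ne_zero ?_ hw0 h.1
    exact_mod_cast (by positivity : (4 * Real.pi : ℝ) ≠ 0)
  rw [← mul_assoc, ← mul_assoc, one_div, inv_mul_cancel₀ hne, one_mul]

lemma heatConv_eq (d : ℂ) (src : ℝ → ℝ) (x : ℝ) (τ : ℂ) :
    heatConv d src x τ = (1 / (4 * (Real.pi : ℂ) * (d * τ)) ^ (1 / 2 : ℂ)) *
      ∫ y : ℝ, Complex.exp (-((x : ℂ) - y) ^ 2 / (4 * (d * τ))) * (src y : ℂ) := by
  rw [heatConv, ← mul_assoc, ← mul_assoc]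

lemma heatConv_gaussSource {d τ : ℂ} (hd : 0 < d.re) (hτ : 0 < τ.re) {σ : ℝ} (hσ : 0 < σ)
    (hre : 0 < ((d * τ + σ) / (d * τ)).re) (x : ℝ) :
    heatConv d (gaussSource σ) x τ = gaussG d σ x τ := by
  rw [heatConv_eq, gaussian_convolution (mul_mem_slitPlane hd hτ) hσ hre, gaussG]

/-- A function of `(x, τ)` that is jointly continuous for `τ = 0` or `Re τ > 0` is bounded on bounded
parts of the sector, uniformly for bounded `x`. -/
lemma exists_bound_timeSector {ω₀ m : ℝ} (hω₀ : 0 < ω₀) (hm : 0 < m) (h R L : ℝ)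
    {G : ℝ → ℂ → ℂ} (hG : ∀ x τ, τ = 0 ∨ 0 < τ.re →
      ContinuousAt (fun p : ℝ × ℂ => G p.1 p.2) (x, τ)) :
    ∃ C : ℝ, ∀ x ∈ Icc (-R) R, ∀ τ ∈ timeSector ω₀ m h, ‖τ‖ ≤ L → ‖G x τ‖ ≤ C := by
  set K : Set ℂ := {τ : ℂ | 0 ≤ τ.im} ∩ {τ | τ.im ≤ h} ∩ {τ | m * τ.im ≤ ω₀ * τ.re} ∩
    Metric.closedBall 0 L with hK
  have hKc : IsCompact K := by
    refine (isCompact_closedBall (0 : ℂ) L).inter_left ?_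
    refine IsClosed.inter (IsClosed.inter ?_ ?_) ?_
    · exact isClosed_le continuous_const Complex.continuous_im
    · exact isClosed_le Complex.continuous_im continuous_const
    · exact isClosed_le (by fun_prop) (by fun_prop)
  obtain ⟨C, hC⟩ := (isCompact_Icc.prod hKc).exists_bound_of_continuousOn
    (s := Icc (-R) R ×ˢ K) (f := fun p : ℝ × ℂ => G p.1 p.2) (by
      rintro ⟨x, τ⟩ ⟨-, ⟨⟨h1, h2⟩, h3⟩, -⟩
      refine (hG x τ ?_).continuousWithinAt
      by_cases h0 : τ = 0
      · exact Or.inl h0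
      · exact Or.inr (timeSector_re_pos (h := h) hm hω₀ ⟨h0, h1, h2, h3⟩))
  refine ⟨C, fun x hx τ hτ hn => hC (x, τ) ⟨hx, ⟨⟨hτ.2.1, hτ.2.2.1⟩, hτ.2.2.2⟩, ?_⟩⟩
  simpa using hn

lemma mul_add_mem_slitPlane {d τ : ℂ} (hd : 0 < d.re) (hτ : τ = 0 ∨ 0 < τ.re) {σ : ℝ}
    (hσ : 0 < σ) : d * τ + σ ∈ Complex.slitPlane := by
  refine add_ofReal_mem_slitPlane ?_ hσ
  rcases hτ with rfl | hτ
  · left; simp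
  · right; exact mul_mem_slitPlane hd hτ

lemma analyticAt_gaussG {d τ : ℂ} (hd : 0 < d.re) (hτ : 0 < τ.re) {σ : ℝ} (hσ : 0 < σ) (x : ℝ) :
    AnalyticAt ℂ (gaussG d σ x) τ := by
  have h1 := mul_add_mem_slitPlane hd (.inr hτ) hσ
  have h2 := ofReal_div_mem_slitPlane h1 hσ
  have h3 : d * τ + σ ≠ 0 := Complex.slitPlane_ne_zero h1
  have h4 : 4 * (d * τ + σ) ≠ 0 := mul_ne_zero (by norm_num) h3
  unfold gaussG
  have a1 : AnalyticAt ℂ (fun τ : ℂ => d * τ + σ) τ := by fun_prop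
  exact ((analyticAt_const.div a1 h3).cpow analyticAt_const h2).mul
    (analyticAt_const.div (analyticAt_const.mul a1) h4).cexp

lemma continuousAt_gaussG {d τ : ℂ} (hd : 0 < d.re) (hτ : τ = 0 ∨ 0 < τ.re) {σ : ℝ} (hσ : 0 < σ)
    (x : ℝ) : ContinuousAt (fun p : ℝ × ℂ => gaussG d σ p.1 p.2) (x, τ) := by
  have h1 := mul_add_mem_slitPlane hd hτ hσ
  have h2 := ofReal_div_mem_slitPlane h1 hσ
  have h3 : d * τ + σ ≠ 0 := Complex.slitPlane_ne_zero h1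
  have h4 : 4 * (d * τ + σ) ≠ 0 := mul_ne_zero (by norm_num) h3
  unfold gaussG
  have a1 : ContinuousAt (fun p : ℝ × ℂ => d * p.2 + σ) (x, τ) := by fun_prop
  have a2 : ContinuousAt (fun p : ℝ × ℂ => -(p.1 : ℂ) ^ 2) (x, τ) := by fun_prop
  exact ((continuousAt_const.div a1 h3).cpow continuousAt_const h2).mul
    (a2.div (continuousAt_const.mul a1) h4).cexp

lemma gaussG_ne_zero {d τ : ℂ} (hd : 0 < d.re) (hτ : 0 < τ.re) {σ : ℝ} (hσ : 0 < σ) (x : ℝ) :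
    gaussG d σ x τ ≠ 0 := by
  have h1 := mul_add_mem_slitPlane hd (.inr hτ) hσ
  refine mul_ne_zero ?_ (Complex.exp_ne_zero _)
  rw [Ne, Complex.cpow_eq_zero_iff]
  exact fun h => Complex.slitPlane_ne_zero (ofReal_div_mem_slitPlane h1 hσ) h.1

lemma continuous_gaussSource (σ : ℝ) : Continuous (gaussSource σ) := by
  unfold gaussSource
  fun_prop

lemma abs_gaussSource_le {σ : ℝ} (hσ : 0 < σ) (y : ℝ) : |gaussSource σ y| ≤ 1 := by
  rw [gaussSource, abs_of_pos (Real.exp_pos _), Real.exp_le_one_iff]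
  exact div_nonpos_of_nonpos_of_nonneg (by nlinarith [sq_nonneg y]) (by positivity)

lemma four_mul_ofReal_re_pos {d : ℂ} (hd : 0 < d.re) {t : ℝ} (ht : 0 < t) :
    0 < (4 * d * (t : ℂ)).re := by
  rw [Complex.re_mul_ofReal]
  have : (4 * d).re = 4 * d.re := by simp
  rw [this]
  positivity

theorem heatContinuation_gaussG {d : ℂ} (hd : 0 < d.re) {ω₀ m : ℝ} (hω₀ : 0 < ω₀) (hm : 0 < m)
    (h R : ℝ) {σ : ℝ} (hσ : 0 < σ) :
    HeatContinuation d (gaussSource σ) (timeSector ω₀ m h) (Icc (-R) R) (gaussG d σ) where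
  integrable x _ t ht := integrable_heatKernel_mul x (four_mul_ofReal_re_pos hd ht)
    (continuous_gaussSource σ).measurable (abs_gaussSource_le hσ)
  analytic x _ τ hτ := analyticAt_gaussG hd (timeSector_re_pos hm hω₀ hτ) hσ x
  agrees x _ t ht _ := by
    refine (heatConv_gaussSource hd (by simpa using ht) hσ ?_ x).symm
    have hdt : 0 < (d * (t : ℂ)).re := by rw [Complex.re_mul_ofReal]; positivity
    have hne : d * (t : ℂ) ≠ 0 := fun h0 => by simp [h0] at hdt
    rw [add_div, div_self hne, div_eq_mul_inv, Complex.add_re, Complex.re_ofReal_mul,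
      Complex.one_re]
    have := inv_re_pos hdt
    positivity
  bounded L := exists_bound_timeSector hω₀ hm h R L fun x _ hτ => continuousAt_gaussG hd hτ hσ x

lemma exists_lower_bound_gaussG {d : ℂ} (hd : 0 < d.re) (ω₀ R : ℝ) {a : ℝ} (ha : 0 < a) (M : ℝ)
    {σ : ℝ} (hσ : 0 < σ) :
    ∃ c > 0, ∀ x ∈ Icc (-R) R, ∀ μ ∈ Icc a M,
      c ≤ ‖gaussG d σ x ((μ : ℂ) + ω₀ * Complex.I)‖ := by
  have hre : ∀ μ ∈ Icc a M, 0 < ((μ : ℂ) + ω₀ * Complex.I).re := by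
    intro μ hμ
    simpa using ha.trans_le hμ.1
  obtain ⟨c, hc, hcG⟩ := (isCompact_Icc.prod isCompact_Icc).exists_forall_le'
    (s := Icc (-R) R ×ˢ Icc a M) (a := 0)
    (f := fun p : ℝ × ℝ => ‖gaussG d σ p.1 ((p.2 : ℂ) + ω₀ * Complex.I)‖) (by
      rintro ⟨x, μ⟩ ⟨-, hμ⟩
      refine ContinuousAt.continuousWithinAt (ContinuousAt.norm ?_)
      exact ContinuousAt.comp (f := fun p : ℝ × ℝ => (p.1, (p.2 : ℂ) + ω₀ * Complex.I))
        (x := (x, μ)) (continuousAt_gaussG hd (.inr (hre μ hμ)) hσ x) (by fun_prop))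
    (fun p hp => norm_pos_iff.2 (gaussG_ne_zero hd (hre p.2 hp.2) hσ p.1))
  exact ⟨c, hc, fun x hx μ hμ => hcG (x, μ) ⟨hx, hμ⟩⟩

lemma log_norm_gaussG {d τ : ℂ} (hd : 0 < d.re) (hτ : 0 < τ.re) {σ : ℝ} (hσ : 0 < σ) (x : ℝ) :
    Real.log ‖gaussG d σ x τ‖ = (Real.log σ - Real.log ‖d * τ + σ‖) / 2 -
      x ^ 2 * (d * τ + σ).re / (4 * ‖d * τ + σ‖ ^ 2) := by
  have h1 := mul_add_mem_slitPlane hd (.inr hτ) hσ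
  have h3 : 0 < ‖d * τ + σ‖ := norm_pos_iff.2 (Complex.slitPlane_ne_zero h1)
  rw [gaussG, norm_mul, show (1 / 2 : ℂ) = ((1 / 2 : ℝ) : ℂ) by push_cast; rfl,
    Complex.norm_cpow_real, norm_div, Complex.norm_real, Real.norm_of_nonneg hσ.le,
    Complex.norm_exp, Real.log_mul (by positivity) (by positivity), Real.log_exp,
    Real.log_rpow (by positivity), Real.log_div hσ.ne' h3.ne']
  have e : -(x : ℂ) ^ 2 / (4 * (d * τ + σ)) =
      ((-(x ^ 2 / 4) : ℝ) : ℂ) * (d * τ + σ)⁻¹ := by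
    push_cast
    rw [div_eq_mul_inv, mul_inv]
    ring
  rw [e, Complex.re_ofReal_mul, Complex.inv_re, Complex.normSq_eq_norm_sq]
  ring

theorem onBufferCurve_gaussG_iff {d : ℂ} (hd : 0 < d.re) {ω₀ σ : ℝ} (hσ : 0 < σ) {ε : ℝ} (x : ℝ)
    {μ : ℝ} (hε : 0 < ε) (hμ : 0 < μ) :
    OnBufferCurve ε ω₀ (gaussG d σ x ((μ : ℂ) + ω₀ * Complex.I)) μ ↔
      μ ^ 2 = ω₀ ^ 2
        + ε * x ^ 2 * (d.re * μ - d.im * ω₀ + σ) /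
            (2 * ((d.re * μ - d.im * ω₀ + σ) ^ 2 + (d.re * ω₀ + d.im * μ) ^ 2))
        - ε * Real.log (2 * Real.pi * σ)
        + ε / 2 * Real.log
            ((d.re * μ - d.im * ω₀ + σ) ^ 2 + (d.re * ω₀ + d.im * μ) ^ 2) := by
  have hτ : 0 < ((μ : ℂ) + ω₀ * Complex.I).re := by simpa using hμ
  have hw := Complex.slitPlane_ne_zero (mul_add_mem_slitPlane hd (.inr hτ) hσ)
  rw [onBufferCurve_iff_sq hε, and_iff_right (gaussG_ne_zero hd hτ hσ x),
    log_norm_gaussG hd hτ hσ, Real.log_mul (by positivity) hσ.ne']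
  set w : ℂ := d * ((μ : ℂ) + ω₀ * Complex.I) + σ with hwdef
  have hre : w.re = d.re * μ - d.im * ω₀ + σ := by simp [hwdef]
  have him : w.im = d.re * ω₀ + d.im * μ := by simp [hwdef]
  have hn : (d.re * μ - d.im * ω₀ + σ) ^ 2 + (d.re * ω₀ + d.im * μ) ^ 2 = ‖w‖ ^ 2 := by
    rw [← hre, ← him, ← Complex.normSq_eq_norm_sq, Complex.normSq_apply]
    ring
  rw [hn, hre, Real.log_pow]
  have hn0 : ‖w‖ ≠ 0 := norm_ne_zero_iff.2 hw
  have e : ∀ A : ℝ, ω₀ ^ 2 - ε * Real.log (2 * Real.pi) - 2 * ε *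
      ((Real.log σ - Real.log ‖w‖) / 2 - x ^ 2 * A / (4 * ‖w‖ ^ 2)) =
      ω₀ ^ 2 + ε * x ^ 2 * A / (2 * ‖w‖ ^ 2) - ε * (Real.log (2 * Real.pi) + Real.log σ) +
        ε / 2 * ((2 : ℕ) * Real.log ‖w‖) := by
    intro A
    push_cast
    field_simp
    ring
  rw [e]

/-! ### Error-function sources -/

lemma hasDerivAt_erfComplex (z : ℂ) :
    HasDerivAt erfComplex (2 / (Real.sqrt Real.pi : ℂ) * Complex.exp (-z ^ 2)) z := by
  obtain ⟨P, hP⟩ := (convex_univ (𝕜 := ℝ) (E := ℂ)).exists_forall_hasDerivWithinAt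
    (f := fun z : ℂ => Complex.exp (-z ^ 2)) (by fun_prop)
  have h1 : erfComplex = fun z => 2 / (Real.sqrt Real.pi : ℂ) * (P z - P 0) := by
    ext z
    have := integral_affine_of_primitive (S := univ) (f := fun z : ℂ => Complex.exp (-z ^ 2))
      (by fun_prop) hP zero_le_one 0 z (fun _ _ => mem_univ _)
    simp only [zero_add, Complex.ofReal_one, one_mul, Complex.ofReal_zero, zero_mul] at this
    rw [erfComplex, ← this]
    simp only [mul_comm z]
  rw [h1]
  exact (((hP z (mem_univ z)).hasDerivAt Filter.univ_mem).sub_const _).const_mul _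

lemma erfComplex_zero : erfComplex 0 = 0 := by simp [erfComplex]

lemma hasDerivAt_erfReal (x : ℝ) :
    HasDerivAt erfReal (2 / Real.sqrt Real.pi * Real.exp (-x ^ 2)) x := by
  unfold erfReal
  have hc : Continuous fun t : ℝ => Real.exp (-t ^ 2) := by fun_prop
  exact (hc.integral_hasStrictDerivAt 0 x).hasDerivAt.const_mul _

lemma continuous_erfReal : Continuous erfReal :=
  continuous_iff_continuousAt.2 fun x => (hasDerivAt_erfReal x).continuousAt

lemma erfReal_neg (x : ℝ) : erfReal (-x) = -erfReal x := by
  have h := intervalIntegral.integral_comp_neg (a := 0) (b := x)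
    (fun t : ℝ => Real.exp (-t ^ 2))
  simp only [neg_sq, neg_zero] at h
  rw [erfReal, erfReal, intervalIntegral.integral_symm, ← h]
  ring

lemma abs_erfReal_le (x : ℝ) : |erfReal x| ≤ 2 := by
  have hi : Integrable fun t : ℝ => Real.exp (-t ^ 2) := by
    simpa using integrable_exp_neg_mul_sq one_pos
  have h1 : |∫ t in (0 : ℝ)..x, Real.exp (-t ^ 2)| ≤ Real.sqrt Real.pi := by
    calc |∫ t in (0 : ℝ)..x, Real.exp (-t ^ 2)|
        ≤ ∫ t in uIoc 0 x, Real.exp (-t ^ 2) := by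
          have := intervalIntegral.norm_integral_le_integral_norm_uIoc (a := 0) (b := x)
            (f := fun t : ℝ => Real.exp (-t ^ 2)) (μ := volume)
          simpa [abs_of_pos (Real.exp_pos _)] using this
      _ ≤ ∫ t : ℝ, Real.exp (-t ^ 2) :=
          setIntegral_le_integral hi (.of_forall fun t => (Real.exp_pos _).le)
      _ = Real.sqrt Real.pi := by simpa using integral_gaussian 1
  have h2 : 0 < Real.sqrt Real.pi := Real.sqrt_pos.2 Real.pi_pos
  rw [erfReal, abs_mul, abs_of_pos (by positivity)]
  calc _ ≤ 2 / Real.sqrt Real.pi * Real.sqrt Real.pi := by gcongr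
    _ = 2 := by field_simp

lemma continuous_erfSource (Iave Ie : ℝ) : Continuous (erfSource Iave Ie) := by
  unfold erfSource
  have := continuous_erfReal
  fun_prop

lemma abs_erfSource_le (Iave Ie y : ℝ) : |erfSource Iave Ie y| ≤ |Iave| + |Ie| * 2 := by
  refine (abs_add_le _ _).trans ?_
  rw [abs_mul]
  gcongr
  exact abs_erfReal_le y

/-- Both sides vanish at `x = 0` by oddness, and their `x`-derivatives agree because the derivative of
`erf` is a Gaussian source. -/
lemma erf_convolution {w : ℂ} (hw : 0 < w.re) (x : ℝ) :
    (1 / (4 * (Real.pi : ℂ) * w) ^ (1 / 2 : ℂ)) *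
      ∫ y : ℝ, Complex.exp (-((x : ℂ) - y) ^ 2 / (4 * w)) * (erfReal y : ℂ) =
    erfComplex ((x : ℂ) / (1 + 4 * w) ^ (1 / 2 : ℂ)) := by
  have hsl : w ∈ Complex.slitPlane := Or.inl hw
  have h4 : 0 < (4 * w).re := by simpa using hw
  set s : ℂ := (1 + 4 * w) ^ (1 / 2 : ℂ) with hs
  have hs2 : s ^ 2 = 1 + 4 * w := cpow_half_sq _
  have h1w : 1 + 4 * w ∈ Complex.slitPlane := by
    left
    simp
    positivity
  have h1w0 := Complex.slitPlane_ne_zero h1w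
  have hs0 : s ≠ 0 := by
    intro h
    rw [h] at hs2
    exact h1w0 (by rw [← hs2]; simp)
  set c : ℂ := 1 / (4 * (Real.pi : ℂ) * w) ^ (1 / 2 : ℂ) with hc
  set k : ℝ → ℂ := fun u => Complex.exp (-((0 : ℝ) - u : ℂ) ^ 2 / (4 * w)) with hk
  have hki : Integrable k := integrable_heatKernel 0 h4
  have hkeq : ∀ u v : ℝ, Complex.exp (-((u : ℂ) - v) ^ 2 / (4 * w)) = k (u - v) := by
    intro u v
    simp only [hk]
    push_cast
    congr 2
    ring
  set Ψ : ℝ → ℂ := fun x => ∫ u : ℝ, k u * (erfReal (x - u) : ℂ) with hΨ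
  have hconv : ∀ (f : ℝ → ℝ) (x : ℝ),
      ∫ y : ℝ, Complex.exp (-((x : ℂ) - y) ^ 2 / (4 * w)) * (f y : ℂ) =
        ∫ u : ℝ, k u * (f (x - u) : ℂ) := by
    intro f x
    rw [← integral_sub_left_eq_self (fun u : ℝ => k u * (f (x - u) : ℂ)) volume x]
    simp only [hkeq, sub_sub_cancel]
  have hΨd : ∀ x : ℝ, HasDerivAt Ψ
      (∫ u : ℝ, k u * ((2 / Real.sqrt Real.pi * Real.exp (-(x - u) ^ 2) : ℝ) : ℂ)) x := by
    intro x
    refine (hasDerivAt_integral_of_dominated_loc_of_deriv_le (𝕜 := ℝ) (s := univ)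
      (F := fun (x u : ℝ) => k u * (erfReal (x - u) : ℂ))
      (F' := fun (x u : ℝ) => k u * ((2 / Real.sqrt Real.pi * Real.exp (-(x - u) ^ 2) : ℝ) : ℂ))
      (bound := fun u => ‖k u‖ * (2 / Real.sqrt Real.pi)) Filter.univ_mem
      (.of_forall fun x => ?_) ?_ ?_ (.of_forall fun u x _ => ?_) (hki.norm.mul_const _)
      (.of_forall fun u x _ => ?_)).2
    · have := continuous_erfReal
      exact hki.aestronglyMeasurable.mul (by fun_prop)
    · have := continuous_erfReal
      refine hki.mul_bdd (c := 2) (by fun_prop) (.of_forall fun u => ?_)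
      simpa using abs_erfReal_le (x - u)
    · exact hki.aestronglyMeasurable.mul (by fun_prop)
    · rw [norm_mul, Complex.norm_real, Real.norm_of_nonneg (by positivity)]
      gcongr
      refine mul_le_of_le_one_right (by positivity) ?_
      rw [Real.exp_le_one_iff]
      nlinarith [sq_nonneg (x - u)]
    · have h := (hasDerivAt_erfReal (x - u)).comp x ((hasDerivAt_id x).sub_const u)
      rw [mul_one] at h
      exact (HasDerivAt.ofReal_comp h).const_mul _
  have hder : ∀ x : ℝ, c * ∫ u : ℝ, k u *
      ((2 / Real.sqrt Real.pi * Real.exp (-(x - u) ^ 2) : ℝ) : ℂ) =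
      2 / (Real.sqrt Real.pi : ℂ) * Complex.exp (-((x : ℂ) / s) ^ 2) * (1 / s) := by
    intro x
    have hg := gaussian_convolution hsl (σ := 1 / 4) (by norm_num) (by
      have hw0 := Complex.slitPlane_ne_zero hsl
      rw [add_div, div_self hw0, div_eq_mul_inv, Complex.add_re, Complex.re_ofReal_mul,
        Complex.one_re]
      have := inv_re_pos hw
      positivity) x
    rw [hconv] at hg
    have e1 : ∀ u : ℝ, k u * ((2 / Real.sqrt Real.pi * Real.exp (-(x - u) ^ 2) : ℝ) : ℂ) =
        2 / (Real.sqrt Real.pi : ℂ) * (k u * (gaussSource (1 / 4) (x - u) : ℂ)) := by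
      intro u
      rw [gaussSource]
      norm_num
      ring
    simp only [e1]
    rw [integral_const_mul, mul_left_comm, ← hc] at *
    rw [hg]
    have e2 : w + ((1 / 4 : ℝ) : ℂ) = s ^ 2 / 4 := by rw [hs2]; push_cast; ring
    have e3 : ((1 / 4 : ℝ) : ℂ) / (w + ((1 / 4 : ℝ) : ℂ)) = (1 + 4 * w)⁻¹ := by
      rw [e2, hs2]; push_cast; field_simp
    rw [e3, Complex.inv_cpow _ _ (Complex.slitPlane_arg_ne_pi h1w), ← hs, e2, mul_assoc]
    congr 1
    rw [mul_comm, one_div]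
    congr 2
    field_simp
  have hΨ0 : Ψ 0 = 0 := by
    have h := integral_neg_eq_self (fun u : ℝ => k u * (erfReal (0 - u) : ℂ)) volume
    have h' : ∀ u : ℝ, k (-u) * (erfReal (0 - -u) : ℂ) = -(k u * (erfReal (0 - u) : ℂ)) := by
      intro u
      have : k (-u) = k u := by
        simp only [hk]
        push_cast
        congr 2
        ring
      rw [this, zero_sub, zero_sub, erfReal_neg u, neg_neg]
      push_cast
      ring
    simp only [h', integral_neg] at h
    exact self_eq_neg.1 h.symm
  have hdiff : ∀ x : ℝ, HasDerivAt (fun x : ℝ => c * Ψ x - erfComplex ((x : ℂ) / s)) 0 x := by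
    intro x
    have a1 := (hΨd x).const_mul c
    rw [hder x] at a1
    have a2 : HasDerivAt (fun x : ℝ => erfComplex ((x : ℂ) / s))
        (2 / (Real.sqrt Real.pi : ℂ) * Complex.exp (-((x : ℂ) / s) ^ 2) * (1 / s)) x := by
      have b1 : HasDerivAt (fun x : ℝ => (x : ℂ) / s) (1 / s) x :=
        (Complex.ofRealCLM.hasDerivAt (x := x)).div_const s
      have := (hasDerivAt_erfComplex ((x : ℂ) / s)).scomp x b1
      simpa [Function.comp_def, mul_comm] using this
    have a3 := a1.sub a2
    rw [sub_self] at a3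
    exact a3
  have hconst := is_const_of_deriv_eq_zero (fun x => (hdiff x).differentiableAt)
    (fun x => (hdiff x).deriv) x 0
  simp only [hΨ0, mul_zero, Complex.ofReal_zero, zero_div, erfComplex_zero, sub_zero] at hconst
  rw [hconv]
  exact sub_eq_zero.1 hconst

lemma heatKernel_convolution_one {w : ℂ} (hw : 0 < w.re) (x : ℝ) :
    (1 / (4 * (Real.pi : ℂ) * w) ^ (1 / 2 : ℂ)) *
      ∫ y : ℝ, Complex.exp (-((x : ℂ) - y) ^ 2 / (4 * w)) = 1 := by
  have h4 : 0 < (4 * w).re := by simpa using hw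
  have hw0 : w ≠ 0 := fun h => by simp [h] at hw
  have h1 : ∫ y : ℝ, Complex.exp (-((x : ℂ) - y) ^ 2 / (4 * w)) =
      ∫ y : ℝ, Complex.exp (-(4 * w)⁻¹ * (y : ℂ) ^ 2) := by
    rw [← integral_sub_left_eq_self
      (fun y : ℝ => Complex.exp (-(4 * w)⁻¹ * (y : ℂ) ^ 2)) volume x]
    congr 1
    ext y
    push_cast
    rw [div_eq_mul_inv]
    ring_nf
  rw [h1, integral_gaussian_complex (inv_re_pos h4), div_inv_eq_mul,
    show (Real.pi : ℂ) * (4 * w) = 4 * Real.pi * w by ring]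
  refine one_div_mul_cancel ?_
  rw [Ne, Complex.cpow_eq_zero_iff]
  refine fun h => mul_ne_zero (mul_ne_zero (by norm_num) ?_) hw0 h.1
  exact_mod_cast Real.pi_ne_zero

lemma heatConv_erfSource {d τ : ℂ} (hτ : 0 < (d * τ).re) (Iave Ie x : ℝ) :
    heatConv d (erfSource Iave Ie) x τ = erfG d Iave Ie x τ := by
  have h4 : 0 < (4 * (d * τ)).re := by simpa using hτ
  have h1 := heatKernel_convolution_one hτ x
  have h2 := erf_convolution hτ x
  rw [heatConv_eq]
  have e : ∀ y : ℝ, Complex.exp (-((x : ℂ) - y) ^ 2 / (4 * (d * τ))) *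
      (erfSource Iave Ie y : ℂ) =
      Iave * Complex.exp (-((x : ℂ) - y) ^ 2 / (4 * (d * τ))) +
      Ie * (Complex.exp (-((x : ℂ) - y) ^ 2 / (4 * (d * τ))) * (erfReal y : ℂ)) := by
    intro y
    rw [erfSource]
    push_cast
    ring
  simp only [e]
  rw [integral_add ((integrable_heatKernel x h4).const_mul _)
    ((integrable_heatKernel_mul x h4 continuous_erfReal.measurable abs_erfReal_le).const_mul _),
    integral_const_mul, integral_const_mul, mul_add, mul_left_comm, h1, mul_left_comm, h2, erfG,
    mul_one, ← mul_assoc]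

lemma one_add_mem_slitPlane {d τ : ℂ} (hd : 0 < d.re) (hτ : τ = 0 ∨ 0 < τ.re) :
    1 + 4 * d * τ ∈ Complex.slitPlane := by
  have h := mul_add_mem_slitPlane (d := 4 * d) (by simpa using hd) hτ one_pos
  rwa [Complex.ofReal_one, add_comm] at h

lemma differentiable_erfComplex : Differentiable ℂ erfComplex :=
  fun z => (hasDerivAt_erfComplex z).differentiableAt

lemma cpow_half_ne_zero {z : ℂ} (hz : z ∈ Complex.slitPlane) : z ^ (1 / 2 : ℂ) ≠ 0 := by
  rw [Ne, Complex.cpow_eq_zero_iff]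
  exact fun h => Complex.slitPlane_ne_zero hz h.1

lemma analyticAt_erfG {d τ : ℂ} (hd : 0 < d.re) (hτ : 0 < τ.re) (Iave Ie x : ℝ) :
    AnalyticAt ℂ (erfG d Iave Ie x) τ := by
  have h1 := one_add_mem_slitPlane hd (.inr hτ)
  have a1 : AnalyticAt ℂ (fun τ : ℂ => 1 + 4 * d * τ) τ := by fun_prop
  have a2 : AnalyticAt ℂ (fun τ : ℂ => (x : ℂ) / (1 + 4 * d * τ) ^ (1 / 2 : ℂ)) τ :=
    analyticAt_const.div (a1.cpow analyticAt_const h1) (cpow_half_ne_zero h1)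
  unfold erfG
  exact analyticAt_const.add (analyticAt_const.mul
    ((differentiable_erfComplex.analyticAt _).comp (f := fun τ : ℂ =>
      (x : ℂ) / (1 + 4 * d * τ) ^ (1 / 2 : ℂ)) a2))

lemma continuousAt_erfG {d τ : ℂ} (hd : 0 < d.re) (hτ : τ = 0 ∨ 0 < τ.re) (Iave Ie x : ℝ) :
    ContinuousAt (fun p : ℝ × ℂ => erfG d Iave Ie p.1 p.2) (x, τ) := by
  have h1 := one_add_mem_slitPlane hd hτ
  have a1 : ContinuousAt (fun p : ℝ × ℂ => 1 + 4 * d * p.2) (x, τ) := by fun_prop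
  have a0 : ContinuousAt (fun p : ℝ × ℂ => (p.1 : ℂ)) (x, τ) := by fun_prop
  have a2 : ContinuousAt (fun p : ℝ × ℂ => (p.1 : ℂ) / (1 + 4 * d * p.2) ^ (1 / 2 : ℂ)) (x, τ) :=
    a0.div (a1.cpow continuousAt_const h1) (cpow_half_ne_zero h1)
  unfold erfG
  exact continuousAt_const.add (continuousAt_const.mul
    (differentiable_erfComplex.continuous.continuousAt.comp a2))

theorem heatContinuation_erfG {d : ℂ} (hd : 0 < d.re) {ω₀ m : ℝ} (hω₀ : 0 < ω₀) (hm : 0 < m)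
    (h R Iave Ie : ℝ) :
    HeatContinuation d (erfSource Iave Ie) (timeSector ω₀ m h) (Icc (-R) R)
      (erfG d Iave Ie) where
  integrable x _ t ht := integrable_heatKernel_mul x (four_mul_ofReal_re_pos hd ht)
    (continuous_erfSource Iave Ie).measurable (abs_erfSource_le Iave Ie)
  analytic x _ τ hτ := analyticAt_erfG hd (timeSector_re_pos hm hω₀ hτ) Iave Ie x
  agrees x _ t ht _ := by
    refine (heatConv_erfSource ?_ Iave Ie x).symm
    rw [Complex.re_mul_ofReal]
    positivity
  bounded L := exists_bound_timeSector hω₀ hm h R L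
    fun x _ hτ => continuousAt_erfG hd hτ Iave Ie x

theorem mainTheorem2 (d : ℂ) (hd : 0 < d.re) (ω₀ : ℝ) (hω₀ : 0 < ω₀) (μ₀ : ℝ) (hμ₀ : μ₀ ≤ -ω₀) :
    -- the implicit form of the space-time buffer curve
    (∀ (ε : ℝ) (z : ℂ) (μ : ℝ), 0 < ε →
      (OnBufferCurve ε ω₀ z μ ↔
        z ≠ 0 ∧ μ ^ 2 = ω₀ ^ 2 - ε * Real.log (2 * Real.pi) - 2 * ε * Real.log ‖z‖) ∧
      (OnBufferCurve ε ω₀ z μ ↔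
        ‖(Real.sqrt (2 * Real.pi) : ℂ) * z * phaseExp ε ω₀ μ‖ = 1)) ∧
    -- bounded sources, with the convolution integral itself at the complex time
    (∀ src : ℝ → ℝ, Measurable src → (∃ B : ℝ, ∀ y, |src y| ≤ B) →
      ∀ (X : Set ℝ) (a M : ℝ), 0 < a → 0 < (d * ((a : ℂ) + ω₀ * Complex.I)).re →
        ParticularAsymptotics d src ω₀ μ₀ X a M (heatConv d src) ∧
        BufferCurveApprox d src ω₀ μ₀ X a M (heatConv d src) ∧
        (a < ω₀ → ω₀ < M →
          (∃ c > 0, ∀ x ∈ X, ∀ μ ∈ Icc a M,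
            c ≤ ‖heatConv d src x ((μ : ℂ) + ω₀ * Complex.I)‖) →
          BufferCurveLocated d src ω₀ μ₀ X a M (heatConv d src))) ∧
    -- general sources, with the convolution continued analytically to complex times
    (∀ (src : ℝ → ℝ) (X : Set ℝ) (G : ℝ → ℂ → ℂ) (m h : ℝ), 0 < m → ω₀ < h →
      HeatContinuation d src (timeSector ω₀ m h) X G →
      ∀ a M : ℝ, m < a →
        ParticularAsymptotics d src ω₀ μ₀ X a M G ∧
        BufferCurveApprox d src ω₀ μ₀ X a M G ∧
        (a < ω₀ → ω₀ < M →
          (∃ c > 0, ∀ x ∈ X, ∀ μ ∈ Icc a M, c ≤ ‖G x ((μ : ℂ) + ω₀ * Complex.I)‖) →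
          BufferCurveLocated d src ω₀ μ₀ X a M G)) ∧
    -- Gaussian sources
    (∀ σ : ℝ, 0 < σ →
      (∀ (x : ℝ) (τ : ℂ), 0 < τ.re → 0 ≤ τ.im → 0 < ((d * τ + σ) / (d * τ)).re →
        heatConv d (gaussSource σ) x τ = gaussG d σ x τ) ∧
      (∀ R m h : ℝ, 0 < m →
        HeatContinuation d (gaussSource σ) (timeSector ω₀ m h) (Icc (-R) R) (gaussG d σ)) ∧
      (∀ R a M : ℝ, 0 < a →
        ParticularAsymptotics d (gaussSource σ) ω₀ μ₀ (Icc (-R) R) a M (gaussG d σ) ∧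
        BufferCurveApprox d (gaussSource σ) ω₀ μ₀ (Icc (-R) R) a M (gaussG d σ) ∧
        (a < ω₀ → ω₀ < M →
          BufferCurveLocated d (gaussSource σ) ω₀ μ₀ (Icc (-R) R) a M (gaussG d σ))) ∧
      (∀ ε x μ : ℝ, 0 < ε → 0 < μ →
        (OnBufferCurve ε ω₀ (gaussG d σ x ((μ : ℂ) + ω₀ * Complex.I)) μ ↔
          μ ^ 2 = ω₀ ^ 2
            + ε * x ^ 2 * (d.re * μ - d.im * ω₀ + σ) /
                (2 * ((d.re * μ - d.im * ω₀ + σ) ^ 2 + (d.re * ω₀ + d.im * μ) ^ 2))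
            - ε * Real.log (2 * Real.pi * σ)
            + ε / 2 * Real.log
                ((d.re * μ - d.im * ω₀ + σ) ^ 2 + (d.re * ω₀ + d.im * μ) ^ 2)))) ∧
    -- error-function sources
    (∀ Iave Ie : ℝ, 0 < Ie → Ie < Iave →
      (∀ (x : ℝ) (τ : ℂ), 0 < (d * τ).re →
        heatConv d (erfSource Iave Ie) x τ = erfG d Iave Ie x τ) ∧
      (∀ R m h : ℝ, 0 < m →
        HeatContinuation d (erfSource Iave Ie) (timeSector ω₀ m h) (Icc (-R) R)
          (erfG d Iave Ie)) ∧
      (∀ (R : ℝ) (X : Set ℝ) (a M : ℝ), X ⊆ Icc (-R) R → 0 < a →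
        ParticularAsymptotics d (erfSource Iave Ie) ω₀ μ₀ X a M (erfG d Iave Ie) ∧
        BufferCurveApprox d (erfSource Iave Ie) ω₀ μ₀ X a M (erfG d Iave Ie) ∧
        (a < ω₀ → ω₀ < M →
          (∃ c > 0, ∀ x ∈ X, ∀ μ ∈ Icc a M,
            c ≤ ‖erfG d Iave Ie x ((μ : ℂ) + ω₀ * Complex.I)‖) →
          BufferCurveLocated d (erfSource Iave Ie) ω₀ μ₀ X a M (erfG d Iave Ie))) ∧
      (∀ ε x μ : ℝ, 0 < ε → 0 < μ →
        (OnBufferCurve ε ω₀ (erfG d Iave Ie x ((μ : ℂ) + ω₀ * Complex.I)) μ ↔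
          (Iave : ℂ) + Ie * erfComplex
              ((x : ℂ) / (1 + 4 * d * ((μ : ℂ) + ω₀ * Complex.I)) ^ (1 / 2 : ℂ)) ≠ 0 ∧
          μ ^ 2 = ω₀ ^ 2
            - 2 * ε * Real.log ‖(Iave : ℂ) + Ie * erfComplex
                ((x : ℂ) / (1 + 4 * d * ((μ : ℂ) + ω₀ * Complex.I)) ^ (1 / 2 : ℂ))‖
            - ε * Real.log (2 * Real.pi)))) := by
  have hω : ω₀ < ω₀ + 1 := by linarith
  have general : ∀ (src : ℝ → ℝ) (X : Set ℝ) (G : ℝ → ℂ → ℂ) (m h : ℝ), 0 < m → ω₀ < h →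
      HeatContinuation d src (timeSector ω₀ m h) X G →
      ∀ a M : ℝ, m < a →
        ParticularAsymptotics d src ω₀ μ₀ X a M G ∧
        BufferCurveApprox d src ω₀ μ₀ X a M G ∧
        (a < ω₀ → ω₀ < M →
          (∃ c > 0, ∀ x ∈ X, ∀ μ ∈ Icc a M, c ≤ ‖G x ((μ : ℂ) + ω₀ * Complex.I)‖) →
          BufferCurveLocated d src ω₀ μ₀ X a M G) :=
    fun src X G m h hm hh H a M ha =>
      ⟨particularAsymptotics_of_continuation hω₀ hμ₀ hm hh H ha M,
        bufferCurveApprox_of_continuation hω₀ hμ₀ hm hh H ha M,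
        fun haω hωM hc => bufferCurveLocated_of_continuation hω₀ hμ₀ hm hh H ha haω hωM hc⟩
  refine ⟨fun ε z μ hε => ⟨onBufferCurve_iff_sq hε, onBufferCurve_iff_norm⟩, ?_, general, ?_, ?_⟩
  · rintro src hsrc ⟨B, hB⟩ X a M ha hda
    -- the open condition `Re (d(a + iω₀)) > 0` persists for some `m < a`
    obtain ⟨m, hm, hma, hdm⟩ : ∃ m : ℝ, 0 < m ∧ m < a ∧
        0 < (d * ((m : ℂ) + ω₀ * Complex.I)).re := by
      have hcont : Continuous fun m : ℝ => (d * ((m : ℂ) + ω₀ * Complex.I)).re := by fun_prop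
      have h1 : ∀ᶠ m : ℝ in nhdsWithin a (Iio a), 0 < (d * ((m : ℂ) + ω₀ * Complex.I)).re :=
        ((hcont.tendsto a).mono_left nhdsWithin_le_nhds).eventually_const_lt hda
      obtain ⟨m, hm1, hm2⟩ := (h1.and (Ioo_mem_nhdsLT ha)).exists
      exact ⟨m, hm2.1, hm2.2, hm1⟩
    exact general src X _ m (ω₀ + 1) hm hω
      (heatContinuation_heatConv hd hω₀ hdm (ω₀ + 1) hsrc hB X) a M hma
  · intro σ hσ
    refine ⟨fun x τ hτ _ hre => heatConv_gaussSource hd hτ hσ hre x,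
      fun R m h hm => heatContinuation_gaussG hd hω₀ hm h R hσ, fun R a M ha => ?_,
      fun ε x μ hε hμ => onBufferCurve_gaussG_iff hd hσ x hε hμ⟩
    obtain ⟨h1, h2, h3⟩ := general _ _ _ (a / 2) (ω₀ + 1) (half_pos ha) hω
      (heatContinuation_gaussG hd hω₀ (half_pos ha) (ω₀ + 1) R hσ) a M (half_lt_self ha)
    exact ⟨h1, h2, fun haω hωM => h3 haω hωM (exists_lower_bound_gaussG hd ω₀ R ha M hσ)⟩
  · intro Iave Ie _ _
    refine ⟨fun x τ hτ => heatConv_erfSource hτ Iave Ie x,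
      fun R m h hm => heatContinuation_erfG hd hω₀ hm h R Iave Ie,
      fun R X a M hX ha => general _ _ _ (a / 2) (ω₀ + 1) (half_pos ha) hω
        ((heatContinuation_erfG hd hω₀ (half_pos ha) (ω₀ + 1) R Iave Ie).mono hX) a M
        (half_lt_self ha),
      fun ε x μ hε _ => ?_⟩
    rw [onBufferCurve_iff_sq hε, erfG]
    refine and_congr_right fun _ => ?_
    rw [sub_right_comm]
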